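/- Let $(X,d)$ be a metric space. A kernel $K\colon X\times X\to\mathbb{C}$ is called conditionally strictly negative definite if it is hermitian, $K(x,y)=\overline{K(y,x)}$, and $$\sum_{x,y\in X}\lambda(x)\overline{\lambda(y)}K(x,y)<0$$ for every finitely supported function $\lambda\colon X\to\mathbb{C}$ with $\lambda\neq 0$ and $\sum_{x\in X}\lambda(x)=0$. A metric space is called an $\mathbb{R}$-tree if any two points $x,y$ of it are connected by a unique arc (the image of a topological embedding of a closed interval, possibly a single point, with end points $x$ and $y$) and this arc is a geodesic segment (it is the image of an isometric embedding of a closed interval with end points $x$ and $y$). The space $(X,d)$ is called an $\mathbb{R}$-graph if $d$ is a path metric, i.e. any two points are joined by a path and $d(x,y)$ is the infimum of the lengths of the paths from $x$ to $y$, and if for every $x\in X$ there is an $\varepsilon>0$ such that the ball $B(x,\varepsilon)$ with the restricted metric is an $\mathbb{R}$-tree. Statement. Let $(X,d)$ be an $\mathbb{R}$-graph. Then the metric $d$ is a conditionally strictly negative definite kernel on $X$ if and only if $X$ is an $\mathbb{R}$-tree. -/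

import Mathlib

open Set Topology
open scoped ComplexOrder ComplexConjugate

/-- A kernel `K : X × X → ℂ` is conditionally strictly negative definite if it is hermitian and
`∑ x y, c x * conj (c y) * K x y < 0` for every nonzero finitely supported `c : X → ℂ` with
`∑ x, c x = 0`.  (The order on `ℂ`: `z < 0` means that `z` is a negative real number.) -/
def IsCondStrictNegDef {X : Type*} (K : X → X → ℂ) : Prop :=
  (∀ x y, K x y = conj (K y x)) ∧
    ∀ c : X →₀ ℂ, c ≠ 0 → ∑ x ∈ c.support, c x = 0 →
      ∑ x ∈ c.support, ∑ y ∈ c.support, c x * conj (c y) * K x y < 0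

/-- `A` is an arc from `x` to `y`: the image of a topological embedding of a closed interval
which sends the end points of the interval to `x` and `y`.  (The interval may be a point, so that
`{x}` is an arc from `x` to `x`.) -/
def IsArc {X : Type*} [MetricSpace X] (x y : X) (A : Set X) : Prop :=
  ∃ (a b : ℝ) (f : ℝ → X), a ≤ b ∧ IsEmbedding ((Icc a b).domRestrict f) ∧
    f a = x ∧ f b = y ∧ f '' Icc a b = A

/-- `A` is a geodesic segment from `x` to `y`: the image of an isometric embedding of a closed
interval which sends the end points of the interval to `x` and `y`. -/
def IsGeodesicSegment {X : Type*} [MetricSpace X] (x y : X) (A : Set X) : Prop :=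
  ∃ (a b : ℝ) (f : ℝ → X), a ≤ b ∧ Isometry ((Icc a b).domRestrict f) ∧
    f a = x ∧ f b = y ∧ f '' Icc a b = A

/-- An `ℝ`-tree: any two points are joined by a unique arc, and this arc is a geodesic segment. -/
def IsRTree (X : Type*) [MetricSpace X] : Prop :=
  ∀ x y : X, (∃! A : Set X, IsArc x y A) ∧ ∀ A : Set X, IsArc x y A → IsGeodesicSegment x y A

/-- Every point has a ball which, with the restricted metric, is an `ℝ`-tree. -/
def IsLocallyRTree (X : Type*) [MetricSpace X] : Prop :=
  ∀ x : X, ∃ ε : ℝ, 0 < ε ∧ IsRTree (Metric.ball x ε)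

/-- The metric is a path metric (length metric): the distance between two points is the infimum
of the lengths of the paths joining them.  (`dist x y` is always a lower bound of these lengths;
the condition for `r > dist x y` makes it the greatest one, and implies path-connectedness.) -/
def IsLengthMetric (X : Type*) [MetricSpace X] : Prop :=
  ∀ (x y : X) (r : ℝ), dist x y < r → ∃ γ : Path x y, eVariationOn γ univ < ENNReal.ofReal r

/-- An `ℝ`-graph: a space with a path metric that is locally an `ℝ`-tree. -/
structure IsRGraph (X : Type*) [MetricSpace X] : Prop where
  isLengthMetric : IsLengthMetric X
  isLocallyRTree : IsLocallyRTree X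

/-!
The metric of an `ℝ`-tree satisfies the four-point condition, so the Gromov products at a base point
form an ultrametric kernel. Such a kernel is an integral of indicators of partial equivalence
relations, hence positive semidefinite; lowering one diagonal entry a little keeps it ultrametric,
which gives definiteness (`FourPointOn.sum_mul_dist_neg`). This settles one direction.

For the other direction the point is that, if the metric of an `ℝ`-graph is strictly negative
definite, then every local geodesic `c` is a geodesic (`IsGeodesicAtScale.isGeodesicOn`). Otherwise
let `t` be the largest scale at which `c` preserves distances. There are pairs of parameters with
differences decreasing to `t` whose images are joined by shortcuts, and they accumulate at
some pair `(s₀, s₀ + t)`. Inside tree balls around `c s₀` and `c (s₀ + t)` a shortcut leaves and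
rejoins `c` at projections `σ` and `τ`, and since `c` preserves distances
up to `t`, a saving is only possible if `t < τ - σ`
(`IsGeodesicAtScale.exists_forall_near`). In the limit one of two things happens.

* The difference `τ - σ` stays larger than `t`. Then four points of `c` form an exact metric
  rectangle, on which the quadratic form with weights `1, -1, 1, -1` vanishes; this contradicts
  strictness. Only distances enter, so it does not matter whether a shortest shortcut exists.
* The pair `(σ, τ)` converges to `(s₀, s₀ + t)`. Then infinitely many branches of a fixed length leave
  `c` close to one of the two points, and all of them lead towards the other one. In a Hilbert space
  in which the squared distances realize the metric, these branches are almost orthogonal vectors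
  with inner products bounded below against one fixed vector, contrary to Bessel's inequality
  (`IsCondStrictNegDef.not_branches`).

Once local geodesics are geodesics, geodesics extend along paths, so that the space is geodesic, and
two geodesics can be concatenated at a closest point without losing length. The latter property,
`HasStraightConcat`, also holds in every `ℝ`-tree, because there the concatenation is an arc. It
implies the four-point condition, and a geodesic space with the four-point condition is an `ℝ`-tree:
an arc between the ends of a geodesic cannot avoid a point of it, since off that point the
projection to the geodesic is locally constant.
-/

/-! ### Strict negative definiteness from the four-point condition -/

/-- The four-point condition on a subset `S` of a metric space (`0`-hyperbolicity): of the three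
sums of distances of opposite pairs among four points, the two largest are equal. -/
def FourPointOn {X : Type*} [MetricSpace X] (S : Set X) : Prop :=
  ∀ x ∈ S, ∀ y ∈ S, ∀ z ∈ S, ∀ w ∈ S,
    dist x y + dist z w ≤ max (dist x z + dist y w) (dist x w + dist y z)

/-- The quadratic form of the indicator kernel of a partial equivalence relation is a sum of
squares, one for each class. -/
theorem sum_mul_indicator_nonneg {X : Type*} (S : Finset X) (a : X → ℝ) (R : X → X → Prop)
    [DecidableRel R] (symm : ∀ x ∈ S, ∀ y ∈ S, R x y → R y x)
    (trans : ∀ x ∈ S, ∀ y ∈ S, ∀ z ∈ S, R x y → R y z → R x z) :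
    0 ≤ ∑ x ∈ S, ∑ y ∈ S, a x * a y * (if R x y then 1 else 0) := by
  classical
  induction S using Finset.strongInduction with
  | H S ih =>
    by_cases hS : ∃ x0 ∈ S, R x0 x0
    · obtain ⟨x0, hx0, hR⟩ := hS
      -- split off the class of `x0`
      set C := S.filter (fun y => R x0 y) with hC
      set D := S.filter (fun y => ¬ R x0 y) with hD
      have hsplit : ∀ f : X → ℝ, ∑ x ∈ S, f x = ∑ x ∈ C, f x + ∑ x ∈ D, f x := fun f =>
        (Finset.sum_filter_add_sum_filter_not S _ f).symm
      have hDS : D ⊂ S := by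
        refine Finset.filter_ssubset.2 ⟨x0, hx0, by simpa using hR⟩
      have ihD := ih D hDS (fun x hx y hy => symm x (hDS.1 hx) y (hDS.1 hy))
        (fun x hx y hy z hz => trans x (hDS.1 hx) y (hDS.1 hy) z (hDS.1 hz))
      have hCC : ∀ x ∈ C, ∀ y ∈ C, R x y := by
        intro x hx y hy
        simp only [hC, Finset.mem_filter] at hx hy
        exact trans x hx.1 x0 hx0 y hy.1 (symm _ hx0 _ hx.1 hx.2) hy.2
      have hCD : ∀ x ∈ C, ∀ y ∈ D, ¬ R x y := by
        intro x hx y hy h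
        simp only [hC, hD, Finset.mem_filter] at hx hy
        exact hy.2 (trans x0 hx0 x hx.1 y hy.1 hx.2 h)
      have hDC : ∀ x ∈ D, ∀ y ∈ C, ¬ R x y := fun x hx y hy h =>
        hCD y hy x hx (symm x (hDS.1 hx) y (Finset.mem_filter.1 hy).1 h)
      have e1 : ∑ x ∈ C, ∑ y ∈ S, a x * a y * (if R x y then (1 : ℝ) else 0)
          = (∑ x ∈ C, a x) * (∑ x ∈ C, a x) := by
        rw [Finset.sum_mul_sum]
        refine Finset.sum_congr rfl fun x hx => ?_
        rw [hsplit, Finset.sum_eq_zero (s := D), add_zero]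
        · exact Finset.sum_congr rfl fun y hy => by rw [if_pos (hCC x hx y hy), mul_one]
        · intro y hy; rw [if_neg (hCD x hx y hy), mul_zero]
      have e2 : ∑ x ∈ D, ∑ y ∈ S, a x * a y * (if R x y then (1 : ℝ) else 0)
          = ∑ x ∈ D, ∑ y ∈ D, a x * a y * (if R x y then (1 : ℝ) else 0) := by
        refine Finset.sum_congr rfl fun x hx => ?_
        rw [hsplit, Finset.sum_eq_zero (s := C), zero_add]
        intro y hy; rw [if_neg (hDC x hx y hy), mul_zero]
      rw [hsplit, e1, e2]
      exact add_nonneg (mul_self_nonneg _) ihD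
    · push Not at hS
      refine (Finset.sum_eq_zero fun x hx => Finset.sum_eq_zero fun y hy => ?_).ge
      rw [if_neg, mul_zero]
      exact fun h => hS x hx (trans x hx y hy x hx h (symm x hx y hy h))

/-- A nonnegative symmetric kernel with `min (g x y) (g y z) ≤ g x z` is positive semidefinite:
it is the integral over `u` of the indicators of `u < g x y`, and each of these is a partial
equivalence relation. -/
theorem sum_mul_ultrametric_nonneg {X : Type*} (S : Finset X) (a : X → ℝ) (g : X → X → ℝ)
    (nonneg : ∀ x ∈ S, ∀ y ∈ S, 0 ≤ g x y) (symm : ∀ x ∈ S, ∀ y ∈ S, g x y = g y x)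
    (ultra : ∀ x ∈ S, ∀ y ∈ S, ∀ z ∈ S, min (g x y) (g y z) ≤ g x z) :
    0 ≤ ∑ x ∈ S, ∑ y ∈ S, a x * a y * g x y := by
  classical
  obtain ⟨M, hM⟩ : ∃ M : ℝ, ∀ x ∈ S, ∀ y ∈ S, g x y ≤ M := by
    obtain ⟨M, hM⟩ := ((S ×ˢ S).image (fun p => g p.1 p.2)).finite_toSet.bddAbove
    exact ⟨M, fun x hx y hy => hM (Finset.mem_coe.2 (Finset.mem_image.2
      ⟨(x, y), Finset.mem_product.2 ⟨hx, hy⟩, rfl⟩))⟩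
  have hlayer : ∀ x ∈ S, ∀ y ∈ S,
      g x y = ∫ u in Ioc (0 : ℝ) M, (Iio (g x y)).indicator (fun _ => (1 : ℝ)) u := by
    intro x hx y hy
    rw [MeasureTheory.setIntegral_indicator measurableSet_Iio]
    have : Ioc (0 : ℝ) M ∩ Iio (g x y) = Ioo 0 (g x y) := by
      ext u
      simp only [mem_inter_iff, mem_Ioc, mem_Iio, mem_Ioo]
      exact ⟨fun h => ⟨h.1.1, h.2⟩, fun h => ⟨⟨h.1, h.2.le.trans (hM x hx y hy)⟩, h.2⟩⟩
    rw [this]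
    simp [nonneg x hx y hy]
  have hint : ∀ x y, MeasureTheory.IntegrableOn
      (fun u => a x * a y * (Iio (g x y)).indicator (fun _ => (1 : ℝ)) u) (Ioc (0 : ℝ) M) := by
    intro x y
    refine MeasureTheory.Integrable.const_mul ?_ _
    exact (MeasureTheory.integrable_const (1 : ℝ)).indicator measurableSet_Iio
  have e : ∑ x ∈ S, ∑ y ∈ S, a x * a y * g x y = ∫ u in Ioc (0 : ℝ) M,
      ∑ x ∈ S, ∑ y ∈ S, a x * a y * (Iio (g x y)).indicator (fun _ => (1 : ℝ)) u := by
    rw [MeasureTheory.integral_finsetSum _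
      (fun x _ => MeasureTheory.integrable_finsetSum _ (fun y _ => hint x y))]
    refine Finset.sum_congr rfl fun x hx => ?_
    rw [MeasureTheory.integral_finsetSum _ (fun y _ => hint x y)]
    refine Finset.sum_congr rfl fun y hy => ?_
    rw [MeasureTheory.integral_const_mul, ← hlayer x hx y hy]
  rw [e]
  refine MeasureTheory.integral_nonneg fun u => ?_
  have := sum_mul_indicator_nonneg S a (fun x y => u < g x y)
    (fun x hx y hy h => by rwa [symm y hy x hx])
    (fun x hx y hy z hz h1 h2 => (lt_min h1 h2).trans_le (ultra x hx y hy z hz))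
  simpa [indicator_apply] using this

/-- The Gromov products based at `o` form an ultrametric kernel.  It stays one when the diagonal
entry at a point `x0` farthest from `o` is lowered a little, which makes the form definite. -/
theorem FourPointOn.sum_mul_dist_neg {X : Type*} [MetricSpace X] (h : FourPointOn (univ : Set X))
    (S : Finset X) (a : X → ℝ) (hne : ∃ x ∈ S, a x ≠ 0) (hsum : ∑ x ∈ S, a x = 0) :
    ∑ x ∈ S, ∑ y ∈ S, a x * a y * dist x y < 0 := by
  classical
  -- restrict to the support
  wlog hsupp : ∀ x ∈ S, a x ≠ 0 generalizing S
  · have hf : ∀ f : X → ℝ, ∑ x ∈ S.filter (fun x => a x ≠ 0), a x * f x = ∑ x ∈ S, a x * f x := by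
      intro f
      refine Finset.sum_subset (Finset.filter_subset _ _) fun x hx hx' => ?_
      simp only [Finset.mem_filter, hx, true_and, not_not] at hx'
      simp [hx']
    have := this (S.filter (fun x => a x ≠ 0))
      (by obtain ⟨x, hx, hx'⟩ := hne; exact ⟨x, by simp [hx, hx'], hx'⟩)
      (by simpa using (hf (fun _ => 1)).trans (by simpa using hsum))
      (by intro x hx; exact (Finset.mem_filter.1 hx).2)
    have e : ∀ T : Finset X, ∑ x ∈ T, ∑ y ∈ T, a x * a y * dist x y
        = ∑ x ∈ T, a x * ∑ y ∈ T, a y * dist x y := fun T =>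
      Finset.sum_congr rfl fun x _ => by
        rw [Finset.mul_sum]; exact Finset.sum_congr rfl fun y _ => by ring
    rw [e] at this ⊢
    rw [hf] at this
    simpa only [hf] using this
  obtain ⟨o, ho, hao⟩ := hne
  obtain ⟨x0, hx0, hmax⟩ := S.exists_max_image (fun x => dist o x) ⟨o, ho⟩
  have hx0o : x0 ≠ o := by
    rintro rfl
    have : S = {x0} := by
      refine Finset.eq_singleton_iff_unique_mem.2 ⟨ho, fun y hy => ?_⟩
      have := hmax y hy
      simp only [dist_self] at this
      exact (dist_le_zero.1 this).symm
    rw [this] at hsum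
    exact hao (by simpa using hsum)
  set g : X → X → ℝ := fun x y => (dist o x + dist o y - dist x y) / 2 with hg
  have gsymm : ∀ x y, g x y = g y x := fun x y => by simp only [hg, dist_comm x y]; ring
  have gnonneg : ∀ x y, 0 ≤ g x y := fun x y => by
    have := dist_triangle_left x y o
    simp only [hg]; linarith
  have gultra : ∀ x y z, min (g x y) (g y z) ≤ g x z := by
    intro x y z
    have := h o trivial y trivial x trivial z trivial
    rw [min_le_iff]
    simp only [hg]
    rcases le_max_iff.1 this with h1 | h1
    · right; linarith
    · left; rw [dist_comm x y]; linarith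
  have glt : ∀ y ∈ S, y ≠ x0 → g x0 y < g x0 x0 := by
    intro y hy hyx
    have h1 := hmax y hy
    have h2 : 0 < dist x0 y := dist_pos.2 (Ne.symm hyx)
    simp only [hg, dist_self]
    linarith
  obtain ⟨ε, hε, hεle, hεlt⟩ : ∃ ε > 0, ε ≤ g x0 x0 ∧ ∀ y ∈ S, y ≠ x0 → g x0 y ≤ g x0 x0 - ε := by
    obtain ⟨y, hy, hym⟩ := (S.erase x0).exists_max_image (fun y => g x0 y)
      ⟨o, Finset.mem_erase.2 ⟨hx0o.symm, ho⟩⟩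
    have hy' := Finset.mem_erase.1 hy
    refine ⟨g x0 x0 - g x0 y, sub_pos.2 (glt y hy'.2 hy'.1), by linarith [gnonneg x0 y], ?_⟩
    intro z hz hzx
    have := hym z (Finset.mem_erase.2 ⟨hzx, hz⟩)
    linarith
  set g' : X → X → ℝ := fun x y => g x y - if x = x0 ∧ y = x0 then ε else 0 with hg'
  have key := sum_mul_ultrametric_nonneg S a g'
    (by
      intro x hx y hy
      simp only [hg']
      split_ifs with hxy
      · rw [hxy.1, hxy.2]; linarith
      · simpa using gnonneg x y)
    (by
      intro x hx y hy
      simp only [hg', gsymm x y, and_comm])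
    (by
      intro x hx y hy z hz
      by_cases hxz : x = x0 ∧ z = x0
      · rw [hxz.1, hxz.2]
        by_cases hyx : y = x0
        · rw [hyx, min_self]
        · refine (min_le_left _ _).trans ?_
          have := hεlt y hy hyx
          simpa [hg', hyx] using this
      · have h1 : g' x z = g x z := by simp [hg', hxz]
        rw [h1]
        refine (min_le_min ?_ ?_).trans (gultra x y z) <;>
        · simp only [hg']
          split_ifs <;> linarith)
  have e1 : ∑ x ∈ S, ∑ y ∈ S, a x * a y * g' x y
      = ∑ x ∈ S, ∑ y ∈ S, a x * a y * g x y - a x0 * a x0 * ε := by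
    have : ∑ x ∈ S, ∑ y ∈ S, a x * a y * (if x = x0 ∧ y = x0 then ε else 0)
        = a x0 * a x0 * ε := by
      rw [Finset.sum_eq_single_of_mem x0 hx0, Finset.sum_eq_single_of_mem x0 hx0]
      · simp
      · intro y _ hy; simp [hy]
      · intro x _ hx; simp [hx]
    rw [← this, ← Finset.sum_sub_distrib]
    refine Finset.sum_congr rfl fun x _ => ?_
    rw [← Finset.sum_sub_distrib]
    exact Finset.sum_congr rfl fun y _ => by simp only [hg']; ring
  have e2 : ∑ x ∈ S, ∑ y ∈ S, a x * a y * dist x y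
      = - 2 * ∑ x ∈ S, ∑ y ∈ S, a x * a y * g x y := by
    have h1 : ∑ x ∈ S, ∑ y ∈ S, a x * a y * dist o x = 0 := by
      have : ∀ x ∈ S, ∑ y ∈ S, a x * a y * dist o x = 0 := fun x _ => by
        rw [← Finset.sum_mul, ← Finset.mul_sum, hsum]; simp
      exact Finset.sum_eq_zero this
    have h2 : ∑ x ∈ S, ∑ y ∈ S, a x * a y * dist o y = 0 := by
      rw [Finset.sum_comm, ← h1]
      exact Finset.sum_congr rfl fun x _ => Finset.sum_congr rfl fun y _ => by ring
    have h3 : ∑ x ∈ S, ∑ y ∈ S, a x * a y * g x y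
        = (∑ x ∈ S, ∑ y ∈ S, a x * a y * dist o x + ∑ x ∈ S, ∑ y ∈ S, a x * a y * dist o y
          - ∑ x ∈ S, ∑ y ∈ S, a x * a y * dist x y) / 2 := by
      simp only [← Finset.sum_add_distrib, ← Finset.sum_sub_distrib, Finset.sum_div]
      exact Finset.sum_congr rfl fun x _ => Finset.sum_congr rfl fun y _ => by
        simp only [hg]; ring
    rw [h3, h1, h2]; ring
  have hpos : 0 < a x0 * a x0 * ε := mul_pos (mul_self_pos.2 (hsupp x0 hx0)) hε
  rw [e1] at key
  rw [e2]
  linarith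

/-- For a real symmetric kernel it is enough to test the real and the imaginary part of the
coefficients. -/
theorem FourPointOn.isCondStrictNegDef {X : Type*} [MetricSpace X]
    (h : FourPointOn (univ : Set X)) : IsCondStrictNegDef (fun x y : X => (dist x y : ℂ)) := by
  refine ⟨fun x y => by simp [dist_comm], fun c hc hsum => ?_⟩
  have hre : ∑ x ∈ c.support, (c x).re = 0 := by simpa using congrArg Complex.re hsum
  have him : ∑ x ∈ c.support, (c x).im = 0 := by simpa using congrArg Complex.im hsum
  have key : ∀ a : X → ℝ, ∑ x ∈ c.support, a x = 0 →
      ∑ x ∈ c.support, ∑ y ∈ c.support, a x * a y * dist x y ≤ 0 := by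
    intro a ha
    by_cases hne : ∃ x ∈ c.support, a x ≠ 0
    · exact (h.sum_mul_dist_neg _ a hne ha).le
    · push Not at hne
      exact (Finset.sum_eq_zero fun x hx => Finset.sum_eq_zero fun y _ => by simp [hne x hx]).le
  rw [Complex.lt_def]
  constructor
  · have e : (∑ x ∈ c.support, ∑ y ∈ c.support, c x * conj (c y) * (dist x y : ℂ)).re
        = ∑ x ∈ c.support, ∑ y ∈ c.support, (c x).re * (c y).re * dist x y
          + ∑ x ∈ c.support, ∑ y ∈ c.support, (c x).im * (c y).im * dist x y := by
      simp only [Complex.re_sum, ← Finset.sum_add_distrib]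
      refine Finset.sum_congr rfl fun x _ => Finset.sum_congr rfl fun y _ => ?_
      simp only [Complex.mul_re, Complex.conj_re, Complex.conj_im, Complex.ofReal_re,
        Complex.ofReal_im]
      ring
    rw [e, Complex.zero_re]
    obtain ⟨x, hx⟩ := Finsupp.ne_iff.1 hc
    have hx' : x ∈ c.support := Finsupp.mem_support_iff.2 hx
    by_cases h0 : (c x).re = 0
    · have h1 : (c x).im ≠ 0 := fun h1 => hx (Complex.ext h0 h1)
      exact add_neg_of_nonpos_of_neg (key _ hre) (h.sum_mul_dist_neg _ _ ⟨x, hx', h1⟩ him)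
    · exact add_neg_of_neg_of_nonpos (h.sum_mul_dist_neg _ _ ⟨x, hx', h0⟩ hre) (key _ him)
  · rw [Complex.zero_im]
    have e : (∑ x ∈ c.support, ∑ y ∈ c.support, c x * conj (c y) * (dist x y : ℂ)).im
        = ∑ x ∈ c.support, ∑ y ∈ c.support, (c x).im * (c y).re * dist x y
          - ∑ x ∈ c.support, ∑ y ∈ c.support, (c x).re * (c y).im * dist x y := by
      simp only [Complex.im_sum, ← Finset.sum_sub_distrib]
      refine Finset.sum_congr rfl fun x _ => Finset.sum_congr rfl fun y _ => ?_
      simp only [Complex.mul_re, Complex.mul_im, Complex.conj_re, Complex.conj_im,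
        Complex.ofReal_re, Complex.ofReal_im]
      ring
    rw [e, sub_eq_zero, Finset.sum_comm]
    exact Finset.sum_congr rfl fun x _ => Finset.sum_congr rfl fun y _ => by
      rw [dist_comm]; ring

/-! ### Geodesics, projections and `ℝ`-trees -/

/-- `c` restricted to `[a, b]` is an isometric embedding. -/
def IsGeodesicOn {X : Type*} [MetricSpace X] (c : ℝ → X) (a b : ℝ) : Prop :=
  ∀ s ∈ Icc a b, ∀ s' ∈ Icc a b, dist (c s) (c s') = |s - s'|

/-- Any two points are joined by a geodesic, parametrized from `0`. -/
def HasGeodesics (X : Type*) [MetricSpace X] : Prop :=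
  ∀ x y : X, ∃ c : ℝ → X, c 0 = x ∧ c (dist x y) = y ∧ IsGeodesicOn c 0 (dist x y)

/-- If `k` runs through two geodesics, one on `[0, L]` and one on `[L, M]`, and `k L` is a point
of the second one closest to every point of the first one, then no length is lost at `k L`. -/
def HasStraightConcat (X : Type*) [MetricSpace X] : Prop :=
  ∀ (k : ℝ → X) (L M : ℝ), 0 ≤ L → L ≤ M → IsGeodesicOn k 0 L → IsGeodesicOn k L M →
    (∀ v ∈ Icc 0 L, ∀ v' ∈ Icc L M, L - v ≤ dist (k v) (k v')) → dist (k 0) (k M) = M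

section Geodesics

variable {X : Type*} [MetricSpace X]

theorem IsGeodesicOn.mono {c : ℝ → X} {a b a' b' : ℝ} (h : IsGeodesicOn c a b) (ha : a ≤ a')
    (hb : b' ≤ b) : IsGeodesicOn c a' b' := fun s hs s' hs' =>
  h s ⟨ha.trans hs.1, hs.2.trans hb⟩ s' ⟨ha.trans hs'.1, hs'.2.trans hb⟩

theorem IsGeodesicOn.continuousOn {c : ℝ → X} {a b : ℝ} (h : IsGeodesicOn c a b) :
    ContinuousOn c (Icc a b) := by
  refine (LipschitzOnWith.of_dist_le_mul (K := 1) fun s hs s' hs' => ?_).continuousOn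
  rw [h s hs s' hs', NNReal.coe_one, one_mul, Real.dist_eq]

theorem IsGeodesicOn.comp_sub {c : ℝ → X} {a b : ℝ} (h : IsGeodesicOn c a b) (D : ℝ) :
    IsGeodesicOn (fun s => c (D - s)) (D - b) (D - a) := by
  intro s hs s' hs'
  rw [h _ ⟨by linarith [hs.2], by linarith [hs.1]⟩ _ ⟨by linarith [hs'.2], by linarith [hs'.1]⟩,
    ← abs_neg]
  congr 1; ring

theorem IsGeodesicOn.comp_add {c : ℝ → X} {a b : ℝ} (h : IsGeodesicOn c a b) (D : ℝ) :
    IsGeodesicOn (fun s => c (s + D)) (a - D) (b - D) := by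
  intro s hs s' hs'
  rw [h _ ⟨by linarith [hs.1], by linarith [hs.2]⟩ _ ⟨by linarith [hs'.1], by linarith [hs'.2]⟩]
  congr 1; ring

theorem IsGeodesicOn.congr {c c' : ℝ → X} {a b : ℝ} (h : IsGeodesicOn c a b)
    (hcc : ∀ s ∈ Icc a b, c' s = c s) : IsGeodesicOn c' a b := by
  intro s hs s' hs'
  rw [hcc s hs, hcc s' hs', h s hs s' hs']

theorem FourPointOn.mono {S T : Set X} (h : FourPointOn T) (hST : S ⊆ T) : FourPointOn S :=
  fun x hx y hy z hz w hw => h x (hST hx) y (hST hy) z (hST hz) w (hST hw)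

/-- Under the four-point condition, the distance from `z` to a point of a geodesic splits at the
projection of `z`, whose parameter is `(a + b + d(z, c a) - d(z, c b)) / 2`. -/
theorem FourPointOn.dist_geodesic {S : Set X} (hS : FourPointOn S) {c : ℝ → X} {a b : ℝ}
    (hc : IsGeodesicOn c a b) (hcS : ∀ s ∈ Icc a b, c s ∈ S) {z : X} (hz : z ∈ S) {s : ℝ}
    (hs : s ∈ Icc a b) :
    dist z (c s) = |s - (a + b + dist z (c a) - dist z (c b)) / 2|
      + (dist z (c a) + dist z (c b) - (b - a)) / 2 := by
  have hab : a ≤ b := hs.1.trans hs.2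
  have ha : a ∈ Icc a b := ⟨le_rfl, hab⟩
  have hb : b ∈ Icc a b := ⟨hab, le_rfl⟩
  have h1 : dist (c a) (c b) = b - a := by rw [hc a ha b hb, abs_sub_comm, abs_of_nonneg]; linarith
  have h2 : dist (c a) (c s) = s - a := by
    rw [hc a ha s hs, abs_sub_comm, abs_of_nonneg]; linarith [hs.1]
  have h3 : dist (c b) (c s) = b - s := by
    rw [hc b hb s hs, abs_of_nonneg]; linarith [hs.2]
  have h4 := hS _ (hcS a ha) _ (hcS b hb) z hz _ (hcS s hs)
  have h5 := dist_triangle_right z (c a) (c s)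
  have h6 := dist_triangle_right z (c b) (c s)
  rw [dist_comm (c a) z, dist_comm (c b) z] at h4
  apply le_antisymm
  · rcases le_max_iff.1 h4 with h | h
    · have := le_abs_self (s - (a + b + dist z (c a) - dist z (c b)) / 2)
      have := neg_abs_le (s - (a + b + dist z (c a) - dist z (c b)) / 2)
      linarith
    · have := le_abs_self (s - (a + b + dist z (c a) - dist z (c b)) / 2)
      have := neg_abs_le (s - (a + b + dist z (c a) - dist z (c b)) / 2)
      linarith
  · rcases abs_cases (s - (a + b + dist z (c a) - dist z (c b)) / 2) with h | h <;> linarith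

theorem FourPointOn.exists_projection {S : Set X} (hS : FourPointOn S) {c : ℝ → X} {a b : ℝ}
    (hab : a ≤ b) (hc : IsGeodesicOn c a b) (hcS : ∀ s ∈ Icc a b, c s ∈ S) {z : X} (hz : z ∈ S) :
    ∃ σ ∈ Icc a b, ∀ s ∈ Icc a b, dist z (c s) = |s - σ| + dist z (c σ) := by
  have ha : a ∈ Icc a b := ⟨le_rfl, hab⟩
  have hb : b ∈ Icc a b := ⟨hab, le_rfl⟩
  have h1 : dist (c a) (c b) = b - a := by rw [hc a ha b hb, abs_sub_comm, abs_of_nonneg]; linarith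
  have h2 := dist_triangle z (c a) (c b)
  have h3 := dist_triangle z (c b) (c a)
  rw [dist_comm (c b)] at h3
  have hσ : (a + b + dist z (c a) - dist z (c b)) / 2 ∈ Icc a b := ⟨by linarith, by linarith⟩
  refine ⟨_, hσ, fun s hs => ?_⟩
  rw [hS.dist_geodesic hc hcS hz hs, hS.dist_geodesic hc hcS hz hσ]
  simp

/-- Points with different projections to a geodesic are joined through the projections. -/
theorem FourPointOn.add_le_dist_of_projection_ne {S : Set X} (hS : FourPointOn S) {c : ℝ → X}
    {a b : ℝ} (hc : IsGeodesicOn c a b) (hcS : ∀ s ∈ Icc a b, c s ∈ S) {z w : X} (hz : z ∈ S)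
    (hw : w ∈ S) {σ τ : ℝ} (hσ : σ ∈ Icc a b) (hτ : τ ∈ Icc a b) (hne : σ ≠ τ)
    (hzσ : dist z (c τ) = |τ - σ| + dist z (c σ)) (hwτ : dist w (c σ) = |σ - τ| + dist w (c τ)) :
    dist z (c σ) + |σ - τ| + dist w (c τ) ≤ dist z w := by
  have h := hS z hz _ (hcS τ hτ) w hw _ (hcS σ hσ)
  have h1 : 0 < |σ - τ| := abs_pos.2 (sub_ne_zero.2 hne)
  rw [dist_comm (c τ) (c σ), hc σ hσ τ hτ, dist_comm (c τ) w, hzσ, hwτ, abs_sub_comm τ σ] at h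
  rcases le_max_iff.1 h with h | h <;> linarith

end Geodesics

section Concat

variable {X : Type*} [MetricSpace X]

/-- The curve that runs through `e` backwards from `e L` to `e 0`, and then through `c` from the
parameter `σ` on, is at distance `L + (D - σ)` from its start when `c σ` is the point of `c`
closest to `e L`. -/
theorem HasStraightConcat.dist_eq (h : HasStraightConcat X) {c e : ℝ → X} {D σ L : ℝ}
    (hσ : σ ∈ Icc 0 D) (hc : IsGeodesicOn c 0 D) (hL : 0 ≤ L) (he : IsGeodesicOn e 0 L)
    (he0 : e 0 = c σ) (hmin : ∀ s ∈ Icc 0 D, L ≤ dist (e L) (c s)) :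
    dist (e L) (c D) = L + (D - σ) := by
  set k : ℝ → X := fun v => if v ≤ L then e (L - v) else c (v + (σ - L)) with hk
  have k1 : ∀ v ∈ Icc 0 L, k v = e (L - v) := fun v hv => by simp [hk, hv.2]
  have k2 : ∀ v ∈ Icc L (L + (D - σ)), k v = c (v + (σ - L)) := by
    intro v hv
    rcases hv.1.eq_or_lt with h1 | h1
    · subst h1; simp [hk, he0]
    · simp [hk, not_le.2 h1]
  have hLM : L ≤ L + (D - σ) := by linarith [hσ.2]
  have := h k L (L + (D - σ)) hL hLM ?_ ?_ ?_
  · rwa [k1 0 ⟨le_rfl, hL⟩, k2 _ ⟨hLM, le_rfl⟩, sub_zero,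
      show L + (D - σ) + (σ - L) = D by ring] at this
  · refine IsGeodesicOn.congr ?_ k1
    simpa using he.comp_sub L
  · refine IsGeodesicOn.congr ?_ k2
    exact (hc.comp_add (σ - L)).mono (by linarith [hσ.1]) (by linarith)
  · intro v hv v' hv'
    rw [k1 v hv, k2 v' hv']
    have h1 := hmin (v' + (σ - L)) ⟨by linarith [hv'.1, hσ.1], by linarith [hv'.2]⟩
    have h2 := dist_triangle (e L) (e (L - v)) (c (v' + (σ - L)))
    rw [he L ⟨hL, le_rfl⟩ (L - v) ⟨by linarith [hv.2], by linarith [hv.1]⟩, sub_sub_cancel,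
      abs_of_nonneg hv.1] at h2
    linarith

/-- In a geodesic space with straight concatenations, projecting `z` and `w` to a geodesic from
`x` to `y` gives the four-point inequality by the triangle inequality. -/
theorem HasStraightConcat.fourPointOn (h : HasStraightConcat X) (hg : HasGeodesics X) :
    FourPointOn (univ : Set X) := by
  have hproj : ∀ (c : ℝ → X) (D : ℝ), 0 ≤ D → IsGeodesicOn c 0 D → ∀ z, ∃ σ ∈ Icc 0 D,
      dist z (c 0) = σ + dist z (c σ) ∧ dist z (c D) = (D - σ) + dist z (c σ) := by
    intro c D hD hc z
    obtain ⟨σ, hσ, hmin⟩ := isCompact_Icc.exists_isMinOn (nonempty_Icc.2 hD)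
      (f := fun s => dist z (c s))
      ((Continuous.dist continuous_const continuous_id).comp_continuousOn hc.continuousOn)
    obtain ⟨e, he0, heL, he⟩ := hg (c σ) z
    have hmin' : ∀ s ∈ Icc 0 D, dist z (c σ) ≤ dist z (c s) := fun s hs => hmin hs
    rw [dist_comm] at heL he
    refine ⟨σ, hσ, ?_, ?_⟩
    · have := h.dist_eq (c := fun s => c (D - s)) (D := D) (σ := D - σ)
        ⟨by linarith [hσ.2], by linarith [hσ.1]⟩ (by simpa using hc.comp_sub D) dist_nonneg he
        (by simpa using he0) (fun s hs => by
          rw [heL]; exact hmin' _ ⟨by linarith [hs.2], by linarith [hs.1]⟩)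
      rw [heL, sub_self] at this
      linarith
    · have := h.dist_eq hσ hc dist_nonneg he he0 (fun s hs => by rw [heL]; exact hmin' s hs)
      rw [heL] at this
      linarith
  intro x _ y _ z _ w _
  obtain ⟨c, rfl, hcD, hc⟩ := hg x y
  obtain ⟨σ, hσ, z0, zD⟩ := hproj c _ dist_nonneg hc z
  obtain ⟨τ, hτ, w0, wD⟩ := hproj c _ dist_nonneg hc w
  rw [hcD] at zD wD
  have h1 := dist_triangle4 z (c σ) (c τ) w
  rw [hc σ hσ τ hτ, dist_comm (c τ) w] at h1
  rw [dist_comm (c 0) z, dist_comm (c 0) w, dist_comm y w, dist_comm y z, le_max_iff]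
  rcases abs_cases (σ - τ) with h2 | h2
  · left; linarith
  · right; linarith

end Concat

section RTree

variable {X : Type*} [MetricSpace X]

theorem IsArc.of_continuousOn_injOn {f : ℝ → X} {a b : ℝ} (hab : a ≤ b)
    (hf : ContinuousOn f (Icc a b)) (hi : InjOn f (Icc a b)) :
    IsArc (f a) (f b) (f '' Icc a b) := by
  refine ⟨a, b, f, hab, ?_, rfl, rfl, rfl⟩
  have : CompactSpace (Icc a b) := isCompact_iff_compactSpace.1 isCompact_Icc
  refine (Continuous.isClosedEmbedding ?_ ?_).isEmbedding
  · exact continuousOn_iff_continuous_domRestrict.1 hf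
  · exact injOn_iff_injective.1 hi

theorem IsGeodesicOn.injOn {c : ℝ → X} {a b : ℝ} (h : IsGeodesicOn c a b) :
    InjOn c (Icc a b) := by
  intro s hs s' hs' hss
  have := h s hs s' hs'
  rw [hss, dist_self, eq_comm, abs_eq_zero] at this
  linarith

theorem IsGeodesicSegment.dist_add_dist {x y p : X} {A : Set X} (h : IsGeodesicSegment x y A)
    (hp : p ∈ A) : dist x p + dist p y = dist x y := by
  obtain ⟨a, b, f, hab, hf, rfl, rfl, rfl⟩ := h
  obtain ⟨s, hs, rfl⟩ := hp
  have hd : ∀ u ∈ Icc a b, ∀ v ∈ Icc a b, dist (f u) (f v) = |u - v| := fun u hu v hv =>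
    hf.dist_eq ⟨u, hu⟩ ⟨v, hv⟩
  rw [hd a ⟨le_rfl, hab⟩ s hs, hd s hs b ⟨hab, le_rfl⟩, hd a ⟨le_rfl, hab⟩ b ⟨hab, le_rfl⟩,
    abs_sub_comm, abs_of_nonneg (sub_nonneg.2 hs.1), abs_sub_comm,
    abs_of_nonneg (sub_nonneg.2 hs.2), abs_sub_comm, abs_of_nonneg (sub_nonneg.2 hab)]
  ring

theorem IsRTree.hasGeodesics (h : IsRTree X) : HasGeodesics X := by
  intro x y
  obtain ⟨A, hA, -⟩ := (h x y).1
  obtain ⟨a, b, f, hab, hf, rfl, rfl, -⟩ := (h x y).2 A hA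
  have hf' : IsGeodesicOn f a b := fun u hu v hv => hf.dist_eq ⟨u, hu⟩ ⟨v, hv⟩
  have hd : dist (f a) (f b) = b - a := by
    rw [hf' a ⟨le_rfl, hab⟩ b ⟨hab, le_rfl⟩, abs_sub_comm, abs_of_nonneg (sub_nonneg.2 hab)]
  rw [hd]
  exact ⟨fun s => f (s + a), by simp, by simp, by simpa using hf'.comp_add a⟩

/-- In an `ℝ`-tree two geodesics that meet only in a common end point form an arc, and arcs are
geodesic. -/
theorem IsRTree.hasStraightConcat (h : IsRTree X) : HasStraightConcat X := by
  intro k L M hL hLM h1 h2 h12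
  have hu : Icc 0 L ∪ Icc L M = Icc 0 M := Icc_union_Icc_eq_Icc hL hLM
  have hcont : ContinuousOn k (Icc 0 M) := by
    rw [← hu]
    exact h1.continuousOn.union_of_isClosed h2.continuousOn isClosed_Icc isClosed_Icc
  have hmeet : ∀ v ∈ Icc 0 L, ∀ v' ∈ Icc L M, k v = k v' → v = v' := by
    intro v hv v' hv' hvv
    have h3 := h12 v hv v' hv'
    rw [hvv, dist_self] at h3
    have hvL : v = L := le_antisymm hv.2 (by linarith)
    rw [hvL] at hvv ⊢
    exact h2.injOn ⟨le_rfl, hLM⟩ hv' hvv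
  have hinj : InjOn k (Icc 0 M) := by
    rw [← hu]
    rintro v (hv | hv) v' (hv' | hv') hvv
    · exact h1.injOn hv hv' hvv
    · exact hmeet v hv v' hv' hvv
    · exact (hmeet v' hv' v hv hvv.symm).symm
    · exact h2.injOn hv hv' hvv
  have h0M : (0 : ℝ) ≤ M := hL.trans hLM
  have := ((h (k 0) (k M)).2 _ (IsArc.of_continuousOn_injOn h0M hcont hinj)).dist_add_dist
    (mem_image_of_mem k (show L ∈ Icc 0 M from ⟨hL, hLM⟩))
  rw [← this, h1 0 ⟨le_rfl, hL⟩ L ⟨hL, le_rfl⟩, h2 L ⟨le_rfl, hLM⟩ M ⟨hLM, le_rfl⟩,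
    abs_sub_comm, abs_of_nonneg (by linarith), abs_sub_comm, abs_of_nonneg (by linarith)]
  ring

theorem IsRTree.fourPointOn (h : IsRTree X) : FourPointOn (univ : Set X) :=
  h.hasStraightConcat.fourPointOn h.hasGeodesics

/-- An arc between the end points of a geodesic `c` contains `c s`: off `c s`, the parameter of the
projection to `c` is locally constant where it equals `s`, so it cannot pass the value `s`. -/
theorem FourPointOn.mem_image_of_arc (hS : FourPointOn (univ : Set X)) {c f : ℝ → X} {D a b : ℝ}
    (hc : IsGeodesicOn c 0 D) (hab : a ≤ b) (hf : ContinuousOn f (Icc a b)) (hfa : f a = c 0)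
    (hfb : f b = c D) {s : ℝ} (hs : s ∈ Icc 0 D) : c s ∈ f '' Icc a b := by
  by_contra hns
  have h0D : (0 : ℝ) ≤ D := hs.1.trans hs.2
  set σ : X → ℝ := fun z => (0 + D + dist z (c 0) - dist z (c D)) / 2 with hσ
  have hσc : Continuous σ := by fun_prop
  have hd : dist (c 0) (c D) = D := by
    rw [hc 0 ⟨le_rfl, h0D⟩ D ⟨h0D, le_rfl⟩, abs_sub_comm, sub_zero, abs_of_nonneg h0D]
  have hσmem : ∀ z, σ z ∈ Icc 0 D := by
    intro z
    have h2 := dist_triangle z (c 0) (c D)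
    have h3 := dist_triangle z (c D) (c 0)
    rw [dist_comm (c D)] at h3
    exact ⟨by simp only [hσ]; linarith, by simp only [hσ]; linarith⟩
  have hform : ∀ z, ∀ u ∈ Icc 0 D, dist z (c u) = |u - σ z| + dist z (c (σ z)) := by
    intro z u hu
    rw [hS.dist_geodesic hc (fun _ _ => trivial) trivial hu,
      hS.dist_geodesic hc (fun _ _ => trivial) trivial (hσmem z)]
    simp [hσ]
  have hloc : ∀ u ∈ Icc a b, σ (f u) = s → ∀ᶠ v in 𝓝[Icc a b] u, σ (f v) = s := by
    intro u hu hus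
    have hpos : 0 < dist (f u) (c s) := dist_pos.2 fun h => hns ⟨u, hu, h⟩
    have : ∀ᶠ v in 𝓝[Icc a b] u, dist (f v) (f u) < dist (f u) (c s) :=
      (hf u hu) (Metric.ball_mem_nhds _ hpos)
    filter_upwards [this] with v hv
    by_contra hne
    rw [← hus] at hne
    have h1 := hS.add_le_dist_of_projection_ne hc (fun _ _ => trivial) (z := f v) (w := f u)
      trivial trivial (hσmem _) (hσmem _) hne (hform _ _ (hσmem _)) (hform _ _ (hσmem _))
    rw [hus] at h1
    linarith [abs_nonneg (σ (f v) - s), dist_nonneg (x := f v) (y := c (σ (f v)))]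
  have hmem : ∀ u ∈ Icc a b, σ (f u) ≤ s := by
    have hco : ContinuousOn (fun u => σ (f u)) (Icc a b) := hσc.comp_continuousOn hf
    have hσa : σ (f a) = 0 := by simp [hσ, hfa, hd]
    refine IsClosed.Icc_subset_of_forall_mem_nhdsWithin (s := {u | σ (f u) ≤ s}) ?_ ?_ ?_
    · rw [inter_comm]
      exact hco.preimage_isClosed_of_isClosed isClosed_Icc isClosed_Iic
    · simpa [hσa] using hs.1
    · rintro u ⟨hus, hu⟩
      refine nhdsWithin_le_of_mem (Icc_mem_nhdsGT_of_mem hu) ?_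
      have hu' := Ico_subset_Icc_self hu
      rcases (show σ (f u) ≤ s from hus).eq_or_lt with h | h
      · filter_upwards [hloc u hu' h] with v hv using hv.le
      · filter_upwards [(hco u hu').eventually_lt_const h] with v hv using hv.le
  have := hmem b ⟨hab, le_rfl⟩
  have hσb : σ (f b) = D := by simp [hσ, hfb, dist_comm (c D), hd]
  rw [hσb] at this
  have hsD : s = D := le_antisymm hs.2 this
  exact hns ⟨b, ⟨hab, le_rfl⟩, by rw [hfb, hsD]⟩

/-- A geodesic space with the four-point condition is an `ℝ`-tree: an arc between the end points
of a geodesic contains it, hence is its image, since the parameter of the arc varies along the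
geodesic from one end of the arc to the other. -/
theorem FourPointOn.isRTree (hS : FourPointOn (univ : Set X)) (hg : HasGeodesics X) :
    IsRTree X := by
  intro x y
  obtain ⟨c, rfl, hcy, hc⟩ := hg x y
  set D := dist (c 0) y with hD
  have h0D : 0 ≤ D := dist_nonneg
  have harc : IsArc (c 0) y (c '' Icc 0 D) := by
    rw [← hcy]
    exact IsArc.of_continuousOn_injOn h0D hc.continuousOn hc.injOn
  have huniq : ∀ A, IsArc (c 0) y A → A = c '' Icc 0 D := by
    rintro A ⟨a, b, f, hab, hf, hfa, hfb, rfl⟩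
    have hfc : ContinuousOn f (Icc a b) :=
      continuousOn_iff_continuous_domRestrict.2 hf.continuous
    have hsub : ∀ s ∈ Icc 0 D, ∃ u : Icc a b, (Icc a b).domRestrict f u = c s := by
      intro s hs
      obtain ⟨u, hu, hus⟩ := hS.mem_image_of_arc hc hab hfc hfa (hfb.trans hcy.symm) hs
      exact ⟨⟨u, hu⟩, hus⟩
    have : Nonempty (Icc a b) := ⟨⟨a, le_rfl, hab⟩⟩
    choose! g hg using hsub
    have hgc : ContinuousOn g (Icc 0 D) := by
      rw [hf.continuousOn_iff]
      exact hc.continuousOn.congr hg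
    have hg0 : g 0 = ⟨a, le_rfl, hab⟩ :=
      hf.injective ((hg 0 ⟨le_rfl, h0D⟩).trans hfa.symm)
    have hgD : g D = ⟨b, hab, le_rfl⟩ :=
      hf.injective ((hg D ⟨h0D, le_rfl⟩).trans (hcy.trans hfb.symm))
    apply Subset.antisymm
    · rintro _ ⟨u, hu, rfl⟩
      have hivt := intermediate_value_Icc h0D (continuous_subtype_val.comp_continuousOn hgc)
      simp only [Function.comp, hg0, hgD] at hivt
      obtain ⟨s, hs, hsu⟩ := hivt hu
      refine ⟨s, hs, ?_⟩
      rw [← hg s hs]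
      simp [domRestrict, hsu]
    · rintro _ ⟨s, hs, rfl⟩
      exact ⟨g s, (g s).2, hg s hs⟩
  refine ⟨⟨_, harc, huniq⟩, fun A hA => ?_⟩
  rw [huniq A hA]
  exact ⟨0, D, c, h0D, Isometry.of_dist_eq fun u v => hc u u.2 v v.2, rfl, hcy, rfl⟩

end RTree

/-! ### Consequences of strict negative definiteness -/

section NegDef

variable {X : Type*} [MetricSpace X]

theorem IsCondStrictNegDef.sum_support_neg
    (h : IsCondStrictNegDef (fun x y : X => (dist x y : ℂ))) {a : X →₀ ℝ} (ha : a ≠ 0)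
    (hsum : ∑ x ∈ a.support, a x = 0) :
    ∑ x ∈ a.support, ∑ y ∈ a.support, a x * a y * dist x y < 0 := by
  set c : X →₀ ℂ := a.mapRange (fun r : ℝ => (r : ℂ)) Complex.ofReal_zero with hc
  have hcx : ∀ x, c x = a x := fun x => by simp [hc]
  have hsupp : c.support = a.support := by
    ext x; simp [hcx]
  have hc0 : c ≠ 0 := by
    intro h0
    refine ha (Finsupp.ext fun x => ?_)
    have := hcx x
    rw [h0] at this
    simpa using this.symm
  have := h.2 c hc0 (by rw [hsupp]; simp only [hcx]; exact_mod_cast hsum)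
  rw [hsupp] at this
  simp only [hcx, Complex.conj_ofReal] at this
  exact_mod_cast this

/-- The quadratic form of the metric, evaluated on a weighted family of points (with repetitions
allowed), is the form of the push-forward of the weights. -/
theorem sum_support_mapDomain {ι : Type*} [Fintype ι] (p : ι → X) (w : ι → ℝ) :
    let a := Finsupp.mapDomain p (Finsupp.equivFunOnFinite.symm w)
    ∑ x ∈ a.support, a x = ∑ i, w i ∧
      ∑ x ∈ a.support, ∑ y ∈ a.support, a x * a y * dist x y
        = ∑ i, ∑ j, w i * w j * dist (p i) (p j) := by
  intro a
  constructor
  · change a.sum (fun _ r => r) = _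
    rw [Finsupp.sum_mapDomain_index (by simp) (by simp), Finsupp.sum_fintype _ _ (by simp)]
    simp
  · change a.sum (fun x r => a.sum (fun y s => r * s * dist x y)) = _
    rw [Finsupp.sum_mapDomain_index (by simp)
      (fun x r s => by simp only [Finsupp.sum, add_mul, Finset.sum_add_distrib]),
      Finsupp.sum_fintype _ _ (by simp)]
    refine Finset.sum_congr rfl fun i _ => ?_
    rw [Finsupp.sum_mapDomain_index (by simp) (fun y r s => by ring),
      Finsupp.sum_fintype _ _ (by simp)]
    simp

theorem IsCondStrictNegDef.sum_nonpos
    (h : IsCondStrictNegDef (fun x y : X => (dist x y : ℂ))) {ι : Type*} [Fintype ι] (p : ι → X)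
    (w : ι → ℝ) (hw : ∑ i, w i = 0) : ∑ i, ∑ j, w i * w j * dist (p i) (p j) ≤ 0 := by
  obtain ⟨h1, h2⟩ := sum_support_mapDomain p w
  rw [← h2]
  by_cases ha : Finsupp.mapDomain p (Finsupp.equivFunOnFinite.symm w) = 0
  · simp [ha]
  · exact (h.sum_support_neg ha (h1.trans hw)).le

/-- A strictly negative definite metric contains no metric rectangle: four points `P R S Q` (in
cyclic order) with opposite sides equal and both diagonals equal to the sum of two sides. -/
theorem IsCondStrictNegDef.not_rectangle
    (h : IsCondStrictNegDef (fun x y : X => (dist x y : ℂ))) {P R S Q : X} {u v : ℝ} (hu : 0 < u)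
    (hv : 0 < v) (hPR : dist P R = u) (hQS : dist Q S = u) (hPQ : dist P Q = v)
    (hRS : dist R S = v) (hPS : dist P S = u + v) (hRQ : dist R Q = u + v) : False := by
  obtain ⟨h1, h2⟩ := sum_support_mapDomain ![P, R, S, Q] ![1, -1, 1, -1]
  set a := Finsupp.mapDomain ![P, R, S, Q]
    (Finsupp.equivFunOnFinite.symm ![(1 : ℝ), -1, 1, -1]) with ha
  have ha0 : a ≠ 0 := by
    intro h0
    have hP : a P = 1 := by
      have e : a = Finsupp.single P 1 + Finsupp.single R (-1) + Finsupp.single S 1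
          + Finsupp.single Q (-1) := by
        rw [ha, Finsupp.mapDomain, Finsupp.sum_fintype _ _ (by simp)]
        simp [Fin.sum_univ_four]
      have hR' : R ≠ P := by rintro rfl; simp at hPR; linarith
      have hS' : S ≠ P := by rintro rfl; simp at hPS; linarith
      have hQ' : Q ≠ P := by rintro rfl; simp at hPQ; linarith
      rw [e]
      simp [hR', hS', hQ']
    rw [h0] at hP
    simp at hP
  have := h.sum_support_neg ha0 (by rw [h1]; simp [Fin.sum_univ_four])
  rw [h2] at this
  simp only [Fin.sum_univ_four, Matrix.cons_val] at this
  simp only [dist_self, dist_comm R P, dist_comm S P, dist_comm Q P, dist_comm S R,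
    dist_comm Q R, dist_comm S Q, hPR, hQS, hPQ, hRS, hPS, hRQ] at this
  linarith

/-- In a metric of negative type, a point `a` cannot have infinitely many branches of length `δ`
that all shorten the distance to `m` by `δ` in the limit: for `N` branch points, a
weight `1` on each of them, `-1` at `m` and `-(N - 1)` at `a` makes the form positive as soon as
`N δ > dist m a`. -/
theorem IsCondStrictNegDef.not_branches
    (h : IsCondStrictNegDef (fun x y : X => (dist x y : ℂ))) {m a : X} {δ : ℝ} (hδ : 0 < δ)
    (hbr : ∀ (N : ℕ) (ε : ℝ), 0 < ε → ∃ v : Fin N → X, (∀ i, dist (v i) a = δ) ∧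
      (∀ i, dist (v i) m ≤ dist m a - δ + ε) ∧ ∀ i j, i ≠ j → 2 * δ - ε ≤ dist (v i) (v j)) :
    False := by
  obtain ⟨N, hN⟩ := exists_nat_gt (dist m a / δ)
  rw [div_lt_iff₀ hδ] at hN
  have hN0 : (0 : ℝ) < N := by
    rcases Nat.eq_zero_or_pos N with h0 | h0
    · rw [h0] at hN; simp at hN; exact absurd hN (not_lt.2 dist_nonneg)
    · exact_mod_cast h0
  set ε := (N * δ - dist m a) / ((N : ℝ) * (N + 2)) with hε
  have hε0 : 0 < ε := div_pos (by linarith) (by positivity)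
  have hεN : ε * (N * (N + 2)) = N * δ - dist m a := div_mul_cancel₀ _ (by positivity)
  obtain ⟨v, hva, hvm, hvv⟩ := hbr N ε hε0
  have := h.sum_nonpos (Sum.elim v ![m, a]) (Sum.elim (fun _ => 1) ![-1, -((N : ℝ) - 1)])
    (by simp [Fin.sum_univ_two]; ring)
  simp only [Fintype.sum_sum_type, Sum.elim_inl, Sum.elim_inr, Fin.sum_univ_two,
    Matrix.cons_val_zero, Matrix.cons_val_one, dist_self, hva, dist_comm a (v _), dist_comm a m,
    dist_comm m (v _), Finset.sum_add_distrib, Finset.sum_const, Finset.card_univ,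
    Fintype.card_fin, nsmul_eq_mul, ← Finset.mul_sum] at this
  have hvv' : ∑ i : Fin N, ∑ j : Fin N, (2 * δ - ε) * (if i = j then (0 : ℝ) else 1)
      ≤ ∑ i : Fin N, ∑ j, 1 * 1 * dist (v i) (v j) := by
    refine Finset.sum_le_sum fun i _ => Finset.sum_le_sum fun j _ => ?_
    split_ifs with hij
    · simp
    · simpa using hvv i j hij
  have hcount : ∑ i : Fin N, ∑ j : Fin N, (2 * δ - ε) * (if i = j then (0 : ℝ) else 1)
      = (2 * δ - ε) * (N * (N - 1)) := by
    have : ∀ i j : Fin N, (if i = j then (0 : ℝ) else 1) = 1 - if i = j then 1 else 0 := by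
      intro i j; split_ifs <;> simp
    simp only [this, ← Finset.mul_sum, Finset.sum_sub_distrib]
    simp
    left; ring
  have hsm : ∑ i, dist (v i) m ≤ N * (dist m a - δ + ε) := by
    refine (Finset.sum_le_sum fun i _ => hvm i).trans ?_
    rw [Finset.sum_const, Finset.card_univ, Fintype.card_fin, nsmul_eq_mul]
  rw [hcount] at hvv'
  simp only [mul_one, one_mul] at this hvv'
  have := mul_pos hε0 hN0
  linarith

end NegDef

/-! ### Local geodesics are geodesics -/

/-- `c` preserves distances up to `ρ` between parameters in `[0, T]`; for small `ρ > 0` this says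
that `c` is a local geodesic. -/
def IsGeodesicAtScale {X : Type*} [MetricSpace X] (c : ℝ → X) (T ρ : ℝ) : Prop :=
  ∀ s ∈ Icc 0 T, ∀ s' ∈ Icc 0 T, |s - s'| ≤ ρ → dist (c s) (c s') = |s - s'|

section LocalGeodesics

open Filter

variable {X : Type*} [MetricSpace X]

theorem IsGeodesicAtScale.continuousOn {c : ℝ → X} {T ρ : ℝ} (h : IsGeodesicAtScale c T ρ)
    (hρ : 0 < ρ) : ContinuousOn c (Icc 0 T) := by
  rw [Metric.continuousOn_iff]
  intro s hs ε hε
  refine ⟨min ε ρ, lt_min hε hρ, fun s' hs' hd => ?_⟩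
  rw [Real.dist_eq] at hd
  rw [h s' hs' s hs (hd.le.trans (min_le_right _ _))]
  exact hd.trans_le (min_le_left _ _)

/-- In a length space, a sphere that separates `x` from `y` contains a point that is almost
between `x` and `y`. -/
theorem IsLengthMetric.exists_mem_sphere (hX : IsLengthMetric X) {x y m : X} {δ r : ℝ}
    (hx : dist m x ≤ δ) (hy : δ ≤ dist m y) (hr : dist x y < r) :
    ∃ e, dist m e = δ ∧ dist x e + dist e y < r := by
  obtain ⟨γ, hγ⟩ := hX x y r hr
  obtain ⟨u, hu⟩ : δ ∈ range (fun u => dist m (γ u)) :=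
    mem_range_of_exists_le_of_exists_ge (continuous_const.dist γ.continuous)
      ⟨0, by simpa using hx⟩ ⟨1, by simpa using hy⟩
  refine ⟨γ u, hu, ?_⟩
  have h1 : edist x (γ u) ≤ eVariationOn γ (univ ∩ Icc 0 u) := by
    have := eVariationOn.edist_le γ (s := univ ∩ Icc 0 u) (x := 0) (y := u)
      ⟨trivial, le_rfl, u.2.1⟩ ⟨trivial, u.2.1, le_rfl⟩
    simpa using this
  have h2 : edist (γ u) y ≤ eVariationOn γ (univ ∩ Icc u 1) := by
    have := eVariationOn.edist_le γ (s := univ ∩ Icc u 1) (x := u) (y := 1)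
      ⟨trivial, le_rfl, u.2.2⟩ ⟨trivial, u.2.2, le_rfl⟩
    simpa using this
  have h3 : edist x (γ u) + edist (γ u) y < ENNReal.ofReal r := by
    refine ((add_le_add h1 h2).trans ?_).trans_lt hγ
    rw [eVariationOn.Icc_add_Icc γ (s := univ) (show (0 : unitInterval) ≤ u from u.2.1)
      (show u ≤ 1 from u.2.2) trivial]
    exact eVariationOn.mono γ (subset_univ _)
  rw [edist_dist, edist_dist, ← ENNReal.ofReal_add dist_nonneg dist_nonneg] at h3
  exact (ENNReal.ofReal_lt_ofReal_iff_of_nonneg (by positivity)).1 h3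

theorem IsGeodesicAtScale.isGeodesicOn_near {c : ℝ → X} {T t δ u : ℝ}
    (hc : IsGeodesicAtScale c T t) (hδt : 2 * δ ≤ t) :
    IsGeodesicOn c (max 0 (u - δ)) (min T (u + δ)) := by
  intro x hx x' hx'
  have h1 := max_le_iff.1 hx.1
  have h2 := le_min_iff.1 hx.2
  have h3 := max_le_iff.1 hx'.1
  have h4 := le_min_iff.1 hx'.2
  exact hc x ⟨h1.1, h2.1⟩ x' ⟨h3.1, h4.1⟩ (abs_le.2 ⟨by linarith, by linarith⟩)

theorem mem_Icc_near {T δ u x : ℝ} :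
    x ∈ Icc (max 0 (u - δ)) (min T (u + δ)) ↔ x ∈ Icc 0 T ∧ |x - u| ≤ δ := by
  rw [mem_Icc, mem_Icc, max_le_iff, le_min_iff, abs_le]
  constructor
  · rintro ⟨⟨h1, h2⟩, h3, h4⟩; exact ⟨⟨h1, h3⟩, by linarith, by linarith⟩
  · rintro ⟨⟨h1, h3⟩, h2, h4⟩; exact ⟨⟨h1, by linarith⟩, h3, by linarith⟩

theorem IsGeodesicAtScale.mem_closedBall {c : ℝ → X} {T t δ u : ℝ}
    (hc : IsGeodesicAtScale c T t) (hδ : 0 < δ) (hδt : 2 * δ ≤ t) (hu : u ∈ Icc 0 T) :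
    ∀ x ∈ Icc (max 0 (u - δ)) (min T (u + δ)), c x ∈ Metric.closedBall (c u) δ := by
  intro x hx
  obtain ⟨h1, h2⟩ := mem_Icc_near.1 hx
  rw [Metric.mem_closedBall, hc x h1 u hu (by linarith)]
  exact h2

/-- Projection of a point to the part of a local geodesic that lies in a ball with the four-point
condition. -/
theorem IsGeodesicAtScale.exists_projection {c : ℝ → X} {T t δ u : ℝ}
    (hc : IsGeodesicAtScale c T t) (hδ : 0 < δ) (hδt : 2 * δ ≤ t) (hu : u ∈ Icc 0 T)
    (h4 : FourPointOn (Metric.closedBall (c u) δ)) {e : X} (he : dist (c u) e ≤ δ) :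
    ∃ σ ∈ Icc 0 T, |σ - u| ≤ δ ∧
      ∀ x ∈ Icc 0 T, |x - u| ≤ δ → dist e (c x) = |x - σ| + dist e (c σ) := by
  have hu' : u ∈ Icc (max 0 (u - δ)) (min T (u + δ)) := mem_Icc_near.2 ⟨hu, by simpa using hδ.le⟩
  obtain ⟨σ, hσ, h⟩ := h4.exists_projection (hu'.1.trans hu'.2) (hc.isGeodesicOn_near hδt)
    (hc.mem_closedBall hδ hδt hu) (Metric.mem_closedBall'.2 he)
  have hσ' := mem_Icc_near.1 hσ
  exact ⟨σ, hσ'.1, hσ'.2, fun x hx hxu => h x (mem_Icc_near.2 ⟨hx, hxu⟩)⟩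

/-- A strictly negative definite metric does not allow points `e n` at distance `δ` from `c u`
that branch off a local geodesic `c` at parameters `τ n → u`, `τ n ≠ u`, and shorten the distance
to `m` by `δ` in the limit. -/
theorem IsCondStrictNegDef.not_branches_along
    (hneg : IsCondStrictNegDef (fun x y : X => (dist x y : ℂ))) {c : ℝ → X} {T t δ u : ℝ}
    (hc : IsGeodesicAtScale c T t) (hδ : 0 < δ) (hδt : 2 * δ ≤ t) (hu : u ∈ Icc 0 T)
    (h4 : FourPointOn (Metric.closedBall (c u) δ)) {m : X} {τ ε : ℕ → ℝ} {e : ℕ → X}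
    (hτT : ∀ n, τ n ∈ Icc 0 T) (hτδ : ∀ n, |τ n - u| ≤ δ) (hτ : Tendsto τ atTop (𝓝 u))
    (hτu : ∃ᶠ n in atTop, τ n ≠ u) (heδ : ∀ n, dist (c u) (e n) = δ)
    (hproj : ∀ n, ∀ x ∈ Icc 0 T, |x - u| ≤ δ →
      dist (e n) (c x) = |x - τ n| + dist (e n) (c (τ n)))
    (hem : ∀ n, dist (e n) m ≤ dist m (c u) - δ + ε n) (hε : Tendsto ε atTop (𝓝 0)) : False := by
  refine hneg.not_branches (m := m) (a := c u) hδ fun N ε0 hε0 => ?_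
  have hev : ∀ᶠ n in atTop, |τ n - u| < ε0 / 2 ∧ ε n < ε0 := by
    refine ((Metric.tendsto_nhds.1 hτ) (ε0 / 2) (by linarith)).and (hε.eventually_lt_const hε0)
  set V : Set ℝ := τ '' {n | (|τ n - u| < ε0 / 2 ∧ ε n < ε0) ∧ τ n ≠ u} with hV
  have hinf : V.Infinite := by
    intro hfin
    have huV : u ∈ Vᶜ := by rintro ⟨n, hn, hnu⟩; exact hn.2 hnu
    have h1 := hτ.eventually (hfin.isClosed.isOpen_compl.mem_nhds huV)
    obtain ⟨n, hn1, hn2, hn3⟩ := (hτu.and_eventually (h1.and hev)).exists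
    exact hn2 ⟨n, ⟨hn3, hn1⟩, rfl⟩
  have hmem : ∀ k : ℕ, ∃ n, ((|τ n - u| < ε0 / 2 ∧ ε n < ε0) ∧ τ n ≠ u) ∧
      τ n = hinf.natEmbedding V k := fun k => (hinf.natEmbedding V k).2
  choose n hn hnk using hmem
  refine ⟨fun i => e (n i), fun i => ?_, fun i => ?_, fun i j hij => ?_⟩
  · rw [dist_comm]; exact heδ _
  · exact (hem _).trans (by linarith [(hn i).1.2])
  · have hne : τ (n i) ≠ τ (n j) := by
      rw [hnk, hnk]
      intro h
      exact hij (Fin.ext ((hinf.natEmbedding V).injective (Subtype.ext h)))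
    have h5 := h4.add_le_dist_of_projection_ne (hc.isGeodesicOn_near hδt)
      (hc.mem_closedBall hδ hδt hu) (z := e (n i)) (w := e (n j))
      (Metric.mem_closedBall'.2 (heδ _).le) (Metric.mem_closedBall'.2 (heδ _).le)
      (mem_Icc_near.2 ⟨hτT _, hτδ _⟩) (mem_Icc_near.2 ⟨hτT _, hτδ _⟩) hne
      (hproj _ _ (hτT _) (hτδ _)) (hproj _ _ (hτT _) (hτδ _))
    have h6 := hproj (n i) u hu (by simpa using hδ.le)
    have h7 := hproj (n j) u hu (by simpa using hδ.le)
    rw [dist_comm, heδ, abs_sub_comm] at h6 h7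
    linarith [(hn i).1.1, (hn j).1.1, abs_nonneg (τ (n i) - τ (n j))]

/-- If `c s` and `c s'` are closer than their parameters, for parameters near `s₀` and `s₀ + t`,
then an almost shortest path from `c s` to `c s'` leaves the ball around `c s₀` at some `e` and
enters the ball around `c (s₀ + t)` at some `e'`; these are recorded with their projections. -/
theorem IsGeodesicAtScale.exists_detour (hX : IsLengthMetric X) {c : ℝ → X} {T t δ s₀ : ℝ}
    (hc : IsGeodesicAtScale c T t) (hδ : 0 < δ) (hδt : 2 * δ ≤ t) (hs₀ : s₀ ∈ Icc 0 T)
    (hu : s₀ + t ∈ Icc 0 T) (h4 : FourPointOn (Metric.closedBall (c s₀) δ))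
    (h4' : FourPointOn (Metric.closedBall (c (s₀ + t)) δ)) {s s' : ℝ} (hs : s ∈ Icc 0 T)
    (hs' : s' ∈ Icc 0 T) (hss : |s - s₀| ≤ δ) (hss' : |s' - (s₀ + t)| ≤ δ)
    (hlt : dist (c s) (c s') < s' - s) :
    ∃ (σ τ : ℝ) (e e' : X), σ ∈ Icc 0 T ∧ τ ∈ Icc 0 T ∧ |σ - s₀| ≤ δ ∧ |τ - (s₀ + t)| ≤ δ ∧
      dist (c s₀) e = δ ∧ dist (c (s₀ + t)) e' = δ ∧
      (∀ x ∈ Icc 0 T, |x - s₀| ≤ δ → dist e (c x) = |x - σ| + dist e (c σ)) ∧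
      (∀ x ∈ Icc 0 T, |x - (s₀ + t)| ≤ δ → dist e' (c x) = |x - τ| + dist e' (c τ)) ∧
      dist e (c s) + dist e e' + dist e' (c s') < s' - s := by
  have hma : dist (c s₀) (c (s₀ + t)) = t := by
    rw [hc _ hs₀ _ hu] <;> simp [abs_of_nonneg (show 0 ≤ t by linarith)]
  have h1 : dist (c s₀) (c s) ≤ δ := by
    rw [dist_comm, hc s hs _ hs₀ (by linarith)]; exact hss
  have h2 : dist (c (s₀ + t)) (c s') ≤ δ := by
    rw [dist_comm, hc s' hs' _ hu (by linarith)]; exact hss'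
  have h3 := dist_triangle_right (c s₀) (c (s₀ + t)) (c s')
  obtain ⟨e, hme, he⟩ := hX.exists_mem_sphere h1 (by linarith) hlt
  have h5 := dist_triangle_right (c s₀) (c (s₀ + t)) e
  obtain ⟨e', hae', he'⟩ := hX.exists_mem_sphere (x := c s') (y := e) (m := c (s₀ + t)) (δ := δ)
    (r := s' - s - dist (c s) e) h2 (by linarith) (by rw [dist_comm]; linarith)
  obtain ⟨σ, hσ, hσ', hproj⟩ := hc.exists_projection hδ hδt hs₀ h4 hme.le
  obtain ⟨τ, hτ, hτ', hproj'⟩ := hc.exists_projection hδ hδt hu h4' hae'.le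
  refine ⟨σ, τ, e, e', hσ, hτ, hσ', hτ', hme, hae', hproj, hproj', ?_⟩
  rw [dist_comm e, dist_comm e e', dist_comm e' (c s')]
  linarith

/-- Near a pair of parameters `s₀`, `s₀ + t`, a local geodesic at scale `t` is a geodesic.
Otherwise there are detours between pairs of parameters converging to `(s₀, s₀ + t)`; let `(σ, τ)`
be a limit of their projections to `c`.  Then `t ≤ τ - σ`.  If `t < τ - σ`, four points of
`c` form a metric rectangle.  If `t = τ - σ`, then `σ = s₀`, `τ = s₀ + t`, and the detours branch off
`c` at infinitely many parameters close to one of these. -/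
theorem IsGeodesicAtScale.exists_forall_near (hX : IsLengthMetric X)
    (hneg : IsCondStrictNegDef (fun x y : X => (dist x y : ℂ))) {c : ℝ → X} {T t δ s₀ : ℝ}
    (hc : IsGeodesicAtScale c T t) (hδ : 0 < δ) (hδt : 2 * δ < t) (hs₀ : s₀ ∈ Icc 0 T)
    (hu : s₀ + t ∈ Icc 0 T) (h4 : FourPointOn (Metric.closedBall (c s₀) δ))
    (h4' : FourPointOn (Metric.closedBall (c (s₀ + t)) δ)) :
    ∃ ε > 0, ∀ s ∈ Icc 0 T, ∀ s' ∈ Icc 0 T, |s - s₀| < ε → |s' - (s₀ + t)| < ε →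
      s' - s ≤ dist (c s) (c s') := by
  by_contra! hcon
  have ht : 0 < t := by linarith
  choose s hs s' hs' hss hss' hlt using fun n : ℕ =>
    hcon (min δ (1 / ((n : ℝ) + 1))) (lt_min hδ (by positivity))
  have hma : dist (c s₀) (c (s₀ + t)) = t := by
    rw [hc _ hs₀ _ hu] <;> simp [abs_of_pos ht]
  choose σ τ e e' hσ hτ hσδ hτδ hme hae hproj hproj' hlen using fun n =>
    hc.exists_detour hX hδ hδt.le hs₀ hu h4 h4' (hs n) (hs' n)
      ((hss n).le.trans (min_le_left _ _)) ((hss' n).le.trans (min_le_left _ _)) (hlt n)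
  have hsδ : ∀ n, |s n - s₀| ≤ δ := fun n => (hss n).le.trans (min_le_left _ _)
  have hsδ' : ∀ n, |s' n - (s₀ + t)| ≤ δ := fun n => (hss' n).le.trans (min_le_left _ _)
  have hs_lim : Tendsto s atTop (𝓝 s₀) := by
    rw [tendsto_iff_dist_tendsto_zero]
    exact squeeze_zero (fun _ => dist_nonneg)
      (fun n => (hss n).le.trans (min_le_right _ _)) tendsto_one_div_add_atTop_nhds_zero_nat
  have hs_lim' : Tendsto s' atTop (𝓝 (s₀ + t)) := by
    rw [tendsto_iff_dist_tendsto_zero]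
    exact squeeze_zero (fun _ => dist_nonneg)
      (fun n => (hss' n).le.trans (min_le_right _ _)) tendsto_one_div_add_atTop_nhds_zero_nat
  -- the projections are joined by a path that is shorter by what the detour spends along `c`
  have hshort : ∀ n, dist (c (σ n)) (c (τ n))
      < s' n - s n - |s n - σ n| - |s' n - τ n| := by
    intro n
    have h1 := hproj n (s n) (hs n) (hsδ n)
    have h2 := hproj' n (s' n) (hs' n) (hsδ' n)
    have h3 := dist_triangle4 (c (σ n)) (e n) (e' n) (c (τ n))
    rw [dist_comm (c (σ n)) (e n)] at h3
    linarith [hlen n]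
  have hfar : ∀ n, t < τ n - σ n := by
    intro n
    by_contra! hle
    have h1 := abs_le.1 (hσδ n)
    have h2 := abs_le.1 (hτδ n)
    have h0 : |σ n - τ n| = τ n - σ n := by rw [abs_sub_comm]; exact abs_of_nonneg (by linarith)
    have h3 := hshort n
    rw [hc _ (hσ n) _ (hτ n) (by rw [h0]; exact hle), h0] at h3
    linarith [neg_abs_le (s n - σ n), le_abs_self (s' n - τ n)]
  obtain ⟨⟨σ₀, τ₀⟩, ⟨hσ₀, hτ₀⟩, φ, hφ, hlim⟩ :=
    ((isCompact_Icc (a := (0 : ℝ)) (b := T)).prod isCompact_Icc).tendsto_subseq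
      (x := fun n => (σ n, τ n)) (fun n => ⟨hσ n, hτ n⟩)
  have hσ_lim : Tendsto (fun n => σ (φ n)) atTop (𝓝 σ₀) :=
    (continuous_fst.tendsto _).comp hlim
  have hτ_lim : Tendsto (fun n => τ (φ n)) atTop (𝓝 τ₀) :=
    (continuous_snd.tendsto _).comp hlim
  have hsφ := hs_lim.comp hφ.tendsto_atTop
  have hsφ' := hs_lim'.comp hφ.tendsto_atTop
  simp only [Function.comp_def] at hsφ hsφ'
  have hcont := hc.continuousOn ht
  have hcσ : Tendsto (fun n => c (σ (φ n))) atTop (𝓝 (c σ₀)) :=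
    (hcont σ₀ hσ₀).tendsto.comp (tendsto_nhdsWithin_iff.2 ⟨hσ_lim, .of_forall fun n => hσ _⟩)
  have hcτ : Tendsto (fun n => c (τ (φ n))) atTop (𝓝 (c τ₀)) :=
    (hcont τ₀ hτ₀).tendsto.comp (tendsto_nhdsWithin_iff.2 ⟨hτ_lim, .of_forall fun n => hτ _⟩)
  have hD : dist (c σ₀) (c τ₀) ≤ t - |s₀ - σ₀| - |s₀ + t - τ₀| := by
    have h1 := le_of_tendsto_of_tendsto' (hcσ.dist hcτ)
      (((hsφ'.sub hsφ).sub (hsφ.sub hσ_lim).abs).sub (hsφ'.sub hτ_lim).abs)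
      (fun n => (hshort (φ n)).le)
    linarith
  have hτσ : t ≤ τ₀ - σ₀ := ge_of_tendsto' (hτ_lim.sub hσ_lim) fun n => (hfar _).le
  have hσ₀δ : |σ₀ - s₀| ≤ δ :=
    le_of_tendsto' (hσ_lim.sub tendsto_const_nhds).abs fun n => hσδ _
  have hτ₀δ : |τ₀ - (s₀ + t)| ≤ δ :=
    le_of_tendsto' (hτ_lim.sub tendsto_const_nhds).abs fun n => hτδ _
  have hσ₀δ' := abs_le.1 hσ₀δ
  have hτ₀δ' := abs_le.1 hτ₀δ
  rcases hτσ.lt_or_eq with hgt | heq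
  · -- the rectangle `c σ₀`, `c (σ₀ + w)`, `c (σ₀ + t)`, `c τ₀` with `w = τ₀ - σ₀ - t`
    have hw : σ₀ + (τ₀ - σ₀ - t) ∈ Icc 0 T := ⟨by linarith [hσ₀.1], by linarith [hτ₀.2]⟩
    have ht' : σ₀ + t ∈ Icc 0 T := ⟨by linarith [hσ₀.1], by linarith [hτ₀.2]⟩
    have hdist : ∀ x ∈ Icc 0 T, ∀ y ∈ Icc 0 T, x ≤ y → y - x ≤ t → dist (c x) (c y) = y - x := by
      intro x hx y hy hxy hyx
      have h0 : |x - y| = y - x := by rw [abs_sub_comm]; exact abs_of_nonneg (by linarith)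
      rw [hc x hx y hy (by rw [h0]; exact hyx), h0]
    have hPS := hdist _ hσ₀ _ ht' (by linarith) (by linarith)
    have hQS := hdist _ ht' _ hτ₀ (by linarith) (by linarith)
    have hPQ : dist (c σ₀) (c τ₀) = t - (τ₀ - σ₀ - t) := by
      apply le_antisymm
      · linarith [neg_abs_le (s₀ + t - τ₀), le_abs_self (s₀ - σ₀)]
      · have := dist_triangle_right (c σ₀) (c (σ₀ + t)) (c τ₀)
        linarith
    refine hneg.not_rectangle (P := c σ₀) (R := c (σ₀ + (τ₀ - σ₀ - t))) (S := c (σ₀ + t))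
      (Q := c τ₀) (u := τ₀ - σ₀ - t) (v := t - (τ₀ - σ₀ - t)) (by linarith) (by linarith)
      ?_ ?_ hPQ ?_ ?_ ?_
    · rw [hdist _ hσ₀ _ hw (by linarith) (by linarith)]; ring
    · rw [dist_comm, hQS]; ring
    · rw [hdist _ hw _ ht' (by linarith) (by linarith)]; ring
    · rw [hPS]; ring
    · rw [hdist _ hw _ hτ₀ (by linarith) (by linarith)]; ring
  · have hD' : dist (c σ₀) (c τ₀) = t := by
      have h0 : |σ₀ - τ₀| = t := by rw [abs_sub_comm, ← heq]; exact abs_of_pos ht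
      rw [hc _ hσ₀ _ hτ₀ h0.le, h0]
    have hσs : σ₀ = s₀ := by
      have : |s₀ - σ₀| = 0 :=
        le_antisymm (by linarith [abs_nonneg (s₀ + t - τ₀)]) (abs_nonneg _)
      linarith [abs_eq_zero.1 this]
    have hτs : τ₀ = s₀ + t := by linarith
    subst hσs
    rw [hτs] at hτ_lim
    -- how far the entry points are from being exactly `δ` closer to the opposite end
    set ε : ℕ → ℝ := fun n =>
      (s' (φ n) - s (φ n) - t) + |s (φ n) - σ₀| + |s' (φ n) - (σ₀ + t)| with hε
    have hε_lim : Tendsto ε atTop (𝓝 0) := by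
      have := (((hsφ'.sub hsφ).sub (tendsto_const_nhds (x := t))).add
        (hsφ.sub (tendsto_const_nhds (x := σ₀))).abs).add
        (hsφ'.sub (tendsto_const_nhds (x := σ₀ + t))).abs
      simpa using this
    have hcs : ∀ n, dist (c (s n)) (c σ₀) = |s n - σ₀| := fun n =>
      hc _ (hs n) _ hσ₀ (by linarith [hsδ n])
    have hcs' : ∀ n, dist (c (s' n)) (c (σ₀ + t)) = |s' n - (σ₀ + t)| := fun n =>
      hc _ (hs' n) _ hu (by linarith [hsδ' n])
    have hne : ∀ n, σ n ≠ σ₀ ∨ τ n ≠ σ₀ + t := by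
      intro n
      by_contra! h
      have := hfar n
      rw [h.1, h.2] at this
      linarith
    have hfreq : ∃ᶠ n in atTop, σ (φ n) ≠ σ₀ ∨ τ (φ n) ≠ σ₀ + t :=
      (Eventually.of_forall fun n => hne (φ n)).frequently
    rcases frequently_or_distrib.1 hfreq with hfr | hfr
    · refine hneg.not_branches_along hc hδ hδt.le hs₀ h4 (m := c (σ₀ + t)) (ε := ε)
        (fun n => hσ (φ n)) (fun n => hσδ (φ n)) hσ_lim hfr (fun n => hme (φ n))
        (fun n => hproj (φ n)) (fun n => ?_) hε_lim
      have h1 := hlen (φ n)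
      have h2 := dist_triangle_right (e (φ n)) (c (σ₀ + t)) (e' (φ n))
      have h3 := dist_triangle_right (c σ₀) (e (φ n)) (c (s (φ n)))
      have h5 := dist_triangle_right (e' (φ n)) (c (σ₀ + t)) (c (s' (φ n)))
      have h6 := dist_triangle4 (e (φ n)) (e' (φ n)) (c (s' (φ n))) (c (σ₀ + t))
      rw [dist_comm (c σ₀) (c (s (φ n))), hcs, hme] at h3
      rw [hcs'] at h6
      rw [dist_comm (c (σ₀ + t)), hma]
      simp only [hε]
      linarith
    · refine hneg.not_branches_along hc hδ hδt.le hu h4' (m := c σ₀) (ε := ε)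
        (fun n => hτ (φ n)) (fun n => hτδ (φ n)) hτ_lim hfr (fun n => hae (φ n))
        (fun n => hproj' (φ n)) (fun n => ?_) hε_lim
      have h1 := hlen (φ n)
      have h3 := dist_triangle_right (c (σ₀ + t)) (e' (φ n)) (c (s' (φ n)))
      have h6 := dist_triangle4 (e' (φ n)) (e (φ n)) (c (s (φ n))) (c σ₀)
      rw [dist_comm (c (σ₀ + t)) (c (s' (φ n))), hcs', hae] at h3
      rw [hcs, dist_comm (e' (φ n)) (e (φ n))] at h6
      rw [hma]
      simp only [hε]
      linarith

/-- In an `ℝ`-graph with strictly negative definite metric, local geodesics are geodesics: the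
largest scale at which `c` is a geodesic cannot be smaller than the length of `c`. -/
theorem IsGeodesicAtScale.isGeodesicOn (hX : IsRGraph X)
    (hneg : IsCondStrictNegDef (fun x y : X => (dist x y : ℂ)))
    (h4 : ∀ x : X, ∃ ε > 0, FourPointOn (Metric.ball x ε)) {c : ℝ → X} {T ρ : ℝ} (hρ : 0 < ρ)
    (hc : IsGeodesicAtScale c T ρ) : IsGeodesicOn c 0 T := by
  by_contra hnot
  set G : Set ℝ := {r | 0 < r ∧ IsGeodesicAtScale c T r} with hG
  have hGT : ∀ r ∈ G, r < T := by
    intro r hr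
    by_contra! hle
    refine hnot fun s hs s' hs' => hr.2 s hs s' hs' (abs_le.2 ⟨?_, ?_⟩)
    · linarith [hs.1, hs'.2]
    · linarith [hs'.1, hs.2]
  have hbdd : BddAbove G := ⟨T, fun r hr => (hGT r hr).le⟩
  set t := sSup G with ht
  have hρt : ρ ≤ t := le_csSup hbdd ⟨hρ, hc⟩
  have ht0 : 0 < t := hρ.trans_le hρt
  have hlt : ∀ s ∈ Icc 0 T, ∀ s' ∈ Icc 0 T, |s - s'| < t → dist (c s) (c s') = |s - s'| := by
    intro s hs s' hs' h
    obtain ⟨r, hr, hlt⟩ := exists_lt_of_lt_csSup (s := G) ⟨ρ, hρ, hc⟩ h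
    exact hr.2 s hs s' hs' hlt.le
  have hcont := hc.continuousOn hρ
  -- the supremum is attained
  have htG : IsGeodesicAtScale c T t := by
    suffices h : ∀ s ∈ Icc 0 T, ∀ s' ∈ Icc 0 T, s ≤ s' → s' - s ≤ t →
        dist (c s) (c s') = |s - s'| by
      intro s hs s' hs' hss
      rcases le_total s s' with hle | hle
      · exact h s hs s' hs' hle (by rw [abs_sub_comm] at hss; exact (le_abs_self _).trans hss)
      · rw [dist_comm, abs_sub_comm]
        exact h s' hs' s hs hle ((le_abs_self _).trans hss)
    intro s hs s' hs' hle hst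
    rcases hle.eq_or_lt with h | hss
    · rw [h]; simp
    have hmem : Ioo s s' ∈ 𝓝[<] s' := Ioo_mem_nhdsLT hss
    have hsub : Ioo s s' ⊆ Icc 0 T := fun x hx => ⟨hs.1.trans hx.1.le, hx.2.le.trans hs'.2⟩
    have hle' : 𝓝[<] s' ≤ 𝓝[Icc 0 T] s' :=
      nhdsWithin_le_of_mem (Filter.mem_of_superset hmem hsub)
    have h1 : Tendsto (fun x => dist (c s) (c x)) (𝓝[<] s') (𝓝 (dist (c s) (c s'))) :=
      tendsto_const_nhds.dist ((hcont s' hs').tendsto.mono_left hle')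
    have h2 : Tendsto (fun x => |s - x|) (𝓝[<] s') (𝓝 |s - s'|) :=
      ((continuous_const.sub continuous_id).abs.tendsto s').mono_left nhdsWithin_le_nhds
    refine tendsto_nhds_unique h1 (h2.congr' ?_)
    filter_upwards [hmem] with x hx
    refine (hlt s hs x (hsub hx) ?_).symm
    rw [abs_sub_comm, abs_of_pos (sub_pos.2 hx.1)]
    linarith [hx.2]
  have htT : t < T := hGT t ⟨ht0, htG⟩
  -- pairs that violate scale `t + 1 / (n + 1)` accumulate at a pair with difference `t`
  have hbad : ∀ n : ℕ, ∃ s ∈ Icc 0 T, ∃ s' ∈ Icc 0 T, t < s' - s ∧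
      s' - s ≤ t + 1 / ((n : ℝ) + 1) ∧ dist (c s) (c s') ≠ |s - s'| := by
    intro n
    by_contra! hcon
    have hpos : (0 : ℝ) < 1 / ((n : ℝ) + 1) := by positivity
    have : t + 1 / ((n : ℝ) + 1) ∈ G := by
      refine ⟨by linarith, fun s hs s' hs' hss => ?_⟩
      rcases le_or_gt |s - s'| t with hle | hgt
      · exact htG s hs s' hs' hle
      · rcases abs_cases (s - s') with h | h
        · rw [h.1] at hss hgt
          rw [dist_comm, abs_sub_comm]
          exact hcon s' hs' s hs hgt hss
        · rw [h.1] at hss hgt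
          exact hcon s hs s' hs' (by linarith) (by linarith)
    linarith [le_csSup hbdd this]
  choose s hs s' hs' hts hst hne using hbad
  obtain ⟨s₀, hs₀, φ, hφ, hsφ⟩ := isCompact_Icc.tendsto_subseq hs
  have hdiff : Tendsto (fun n => s' n - s n) atTop (𝓝 t) := by
    refine tendsto_of_tendsto_of_tendsto_of_le_of_le tendsto_const_nhds ?_
      (fun n => (hts n).le) hst
    simpa using (tendsto_const_nhds (x := t)).add tendsto_one_div_add_atTop_nhds_zero_nat
  have hsφ' : Tendsto (fun n => s' (φ n)) atTop (𝓝 (s₀ + t)) := by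
    have := hsφ.add (hdiff.comp hφ.tendsto_atTop)
    refine this.congr fun n => ?_
    simp
  have hu : s₀ + t ∈ Icc 0 T := isClosed_Icc.mem_of_tendsto hsφ' (.of_forall fun n => hs' _)
  obtain ⟨ε₁, hε₁, h41⟩ := h4 (c s₀)
  obtain ⟨ε₂, hε₂, h42⟩ := h4 (c (s₀ + t))
  set δ := min (min ε₁ ε₂ / 2) (t / 3) with hδ
  have hδ0 : 0 < δ := by positivity
  have hδ1 : δ < ε₁ := by
    have : δ ≤ min ε₁ ε₂ / 2 := min_le_left _ _
    linarith [min_le_left ε₁ ε₂]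
  have hδ2 : δ < ε₂ := by
    have : δ ≤ min ε₁ ε₂ / 2 := min_le_left _ _
    linarith [min_le_right ε₁ ε₂]
  have hδt : δ ≤ t / 3 := min_le_right _ _
  obtain ⟨ε, hε, hnear⟩ := htG.exists_forall_near hX.isLengthMetric hneg hδ0 (by linarith) hs₀ hu
    (h41.mono (Metric.closedBall_subset_ball hδ1)) (h42.mono (Metric.closedBall_subset_ball hδ2))
  obtain ⟨n, hn1, hn2, hn3⟩ := (((Metric.tendsto_nhds.1 hsφ) ε hε).and
    (((Metric.tendsto_nhds.1 hsφ') ε hε).and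
      ((hdiff.comp hφ.tendsto_atTop).eventually_lt_const (show t < 2 * t by linarith)))).exists
  have h1 := hnear _ (hs _) _ (hs' _) hn1 hn2
  have h0 : |s (φ n) - s' (φ n)| = s' (φ n) - s (φ n) := by
    rw [abs_sub_comm]; exact abs_of_pos (by linarith [hts (φ n)])
  refine hne (φ n) (le_antisymm ?_ (by rw [h0]; exact h1))
  -- the upper bound goes through the parameter `s + t`
  have hmid : s (φ n) + t ∈ Icc 0 T :=
    ⟨by linarith [(hs (φ n)).1], by linarith [(hs' (φ n)).2, hts (φ n)]⟩
  simp only [Function.comp] at hn3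
  have h2 := dist_triangle (c (s (φ n))) (c (s (φ n) + t)) (c (s' (φ n)))
  have ha : |s (φ n) - (s (φ n) + t)| = t := by
    rw [abs_sub_comm, add_sub_cancel_left]; exact abs_of_pos ht0
  have hb : |s (φ n) + t - s' (φ n)| = s' (φ n) - (s (φ n) + t) := by
    rw [abs_sub_comm]; exact abs_of_nonneg (by linarith [hts (φ n)])
  rw [htG _ (hs _) _ hmid ha.le, htG _ hmid _ (hs' _) (by rw [hb]; linarith), ha, hb] at h2
  rw [h0]; linarith

end LocalGeodesics

/-! ### `ℝ`-graphs with strictly negative definite metric -/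

section RGraph

variable {X : Type*} [MetricSpace X]

theorem IsLocallyRTree.exists_ball (h : IsLocallyRTree X) (x : X) :
    ∃ ε > 0, FourPointOn (Metric.ball x ε) ∧ ∀ y ∈ Metric.ball x ε, ∀ z ∈ Metric.ball x ε,
      ∃ c : ℝ → X, c 0 = y ∧ c (dist y z) = z ∧ IsGeodesicOn c 0 (dist y z) := by
  obtain ⟨ε, hε, htree⟩ := h x
  refine ⟨ε, hε, fun x hx y hy z hz w hw => ?_, fun y hy z hz => ?_⟩
  · exact htree.fourPointOn ⟨x, hx⟩ trivial ⟨y, hy⟩ trivial ⟨z, hz⟩ trivial ⟨w, hw⟩ trivial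
  · obtain ⟨c, hc0, hc1, hc⟩ := htree.hasGeodesics ⟨y, hy⟩ ⟨z, hz⟩
    exact ⟨fun s => c s, congrArg Subtype.val hc0, congrArg Subtype.val hc1, hc⟩

/-- The concatenation is a local geodesic: in a tree ball around `k L`, every point of the first
geodesic projects to `k L` on the second one. -/
theorem IsRGraph.isGeodesicOn_concat (hX : IsRGraph X)
    (hneg : IsCondStrictNegDef (fun x y : X => (dist x y : ℂ))) {k : ℝ → X} {L M : ℝ}
    (hL : 0 ≤ L) (h1 : IsGeodesicOn k 0 L) (h2 : IsGeodesicOn k L M)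
    (h12 : ∀ v ∈ Icc 0 L, ∀ v' ∈ Icc L M, L - v ≤ dist (k v) (k v')) : IsGeodesicOn k 0 M := by
  have h4 : ∀ x : X, ∃ ε > 0, FourPointOn (Metric.ball x ε) := fun x => by
    obtain ⟨ε, hε, h, -⟩ := hX.isLocallyRTree.exists_ball x
    exact ⟨ε, hε, h⟩
  obtain ⟨ε, hε, hball⟩ := h4 (k L)
  have hδ : 0 < ε / 2 := by linarith
  have hcross : ∀ v ∈ Icc 0 L, ∀ v' ∈ Icc L M, v' - v ≤ ε / 2 →
      dist (k v) (k v') = v' - v := by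
    intro v hv v' hv' hvv
    have hvL : dist (k v) (k L) = L - v := by
      rw [h1 v hv L ⟨hL, le_rfl⟩, abs_sub_comm, abs_of_nonneg (by linarith [hv.2])]
    have hmem : v' ∈ Icc L v' := ⟨hv'.1, le_rfl⟩
    have hmemL : L ∈ Icc L v' := ⟨le_rfl, hv'.1⟩
    have h2' : IsGeodesicOn k L v' := h2.mono le_rfl hv'.2
    obtain ⟨u, hu, hproj⟩ := hball.exists_projection hv'.1 h2' (z := k v) (by
      intro x hx
      rw [Metric.mem_ball, h2' x hx L hmemL, abs_of_nonneg (by linarith [hx.1])]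
      linarith [hx.2, hv.2]) (by
      rw [Metric.mem_ball, hvL]
      linarith [hv'.1])
    have h3 := h12 v hv u ⟨hu.1, hu.2.trans hv'.2⟩
    have h5 := hproj L hmemL
    rw [hvL] at h5
    have huL : |L - u| = 0 := le_antisymm (by linarith) (abs_nonneg _)
    have huL' : u = L := by linarith [abs_eq_zero.1 huL]
    rw [hproj v' hmem, huL', hvL, abs_of_nonneg (by linarith [hv'.1])]
    ring
  refine IsGeodesicAtScale.isGeodesicOn hX hneg h4 hδ fun s hs s' hs' hss => ?_
  rcases le_total s L with hsL | hsL <;> rcases le_total s' L with hsL' | hsL'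
  · exact h1 s ⟨hs.1, hsL⟩ s' ⟨hs'.1, hsL'⟩
  · rw [abs_sub_comm, abs_of_nonneg (by linarith)] at hss ⊢
    exact hcross s ⟨hs.1, hsL⟩ s' ⟨hsL', hs'.2⟩ hss
  · rw [abs_of_nonneg (by linarith)] at hss ⊢
    rw [dist_comm]
    exact hcross s' ⟨hs'.1, hsL'⟩ s ⟨hsL, hs.2⟩ hss
  · exact h2 s ⟨hsL, hs.2⟩ s' ⟨hsL', hs'.2⟩

theorem IsRGraph.hasStraightConcat (hX : IsRGraph X)
    (hneg : IsCondStrictNegDef (fun x y : X => (dist x y : ℂ))) : HasStraightConcat X := by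
  intro k L M hL hLM h1 h2 h12
  have hM : 0 ≤ M := hL.trans hLM
  rw [hX.isGeodesicOn_concat hneg hL h1 h2 h12 0 ⟨le_rfl, hM⟩ M ⟨hM, le_rfl⟩, zero_sub, abs_neg,
    abs_of_nonneg hM]

/-- If `y` and `y'` are close to each other, a geodesic from `x` to `y` is turned into one from `x`
to `y'` by following it up to the point closest to `y'`. -/
theorem IsRGraph.exists_geodesic_of_near (hX : IsRGraph X)
    (hneg : IsCondStrictNegDef (fun x y : X => (dist x y : ℂ))) (x z : X) :
    ∃ r > 0, ∀ y ∈ Metric.ball z r, ∀ y' ∈ Metric.ball z r,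
      (∃ c : ℝ → X, c 0 = x ∧ c (dist x y) = y ∧ IsGeodesicOn c 0 (dist x y)) →
      ∃ c : ℝ → X, c 0 = x ∧ c (dist x y') = y' ∧ IsGeodesicOn c 0 (dist x y') := by
  obtain ⟨ε, hε, -, hgeo⟩ := hX.isLocallyRTree.exists_ball z
  refine ⟨ε / 4, by linarith, fun y hy y' hy' => ?_⟩
  rintro ⟨c, hc0, hcy, hc⟩
  have hT : 0 ≤ dist x y := dist_nonneg
  obtain ⟨u, hu, hmin⟩ := isCompact_Icc.exists_isMinOn (nonempty_Icc.2 hT)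
    (f := fun s => dist y' (c s))
    ((Continuous.dist continuous_const continuous_id).comp_continuousOn hc.continuousOn)
  have hmin' : ∀ s ∈ Icc 0 (dist x y), dist y' (c u) ≤ dist y' (c s) := fun s hs => hmin hs
  rw [Metric.mem_ball] at hy hy'
  have hyu := hmin' _ ⟨hT, le_rfl⟩
  rw [hcy] at hyu
  have h1 := dist_triangle_right y' y z
  have h2 := dist_triangle_left (c u) z y'
  obtain ⟨e, he0, heL, he⟩ := hgeo y' (Metric.mem_ball.2 (by linarith)) (c u)
    (Metric.mem_ball.2 (by linarith))
  set L := dist y' (c u) with hL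
  have hL0 : 0 ≤ L := dist_nonneg
  set k : ℝ → X := fun v => if v ≤ L then e v else c (u + L - v) with hk
  have k1 : ∀ v ∈ Icc 0 L, k v = e v := fun v hv => by simp [hk, hv.2]
  have k2 : ∀ v ∈ Icc L (L + u), k v = c (u + L - v) := by
    intro v hv
    rcases hv.1.eq_or_lt with h | h
    · rw [← h, k1 L ⟨hL0, le_rfl⟩, heL]; simp
    · simp [hk, not_le.2 h]
  have hLu : L ≤ L + u := by linarith [hu.1]
  have hkgeo : IsGeodesicOn k 0 (L + u) := by
    refine hX.isGeodesicOn_concat hneg hL0 (he.congr k1) ?_ ?_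
    · refine IsGeodesicOn.congr ?_ k2
      exact ((hc.mono le_rfl hu.2).comp_sub (u + L)).mono (by linarith) (by linarith)
    · intro v hv v' hv'
      rw [k1 v hv, k2 v' hv']
      have h3 := hmin' (u + L - v') ⟨by linarith [hv'.2], by linarith [hv'.1, hu.2]⟩
      have h4 := dist_triangle y' (e v) (c (u + L - v'))
      have h5 := he 0 ⟨le_rfl, hL0⟩ v hv
      rw [he0, zero_sub, abs_neg, abs_of_nonneg hv.1] at h5
      linarith
  have hM : 0 ≤ L + u := hL0.trans hLu
  have hk0 : k 0 = y' := (k1 0 ⟨le_rfl, hL0⟩).trans he0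
  have hkM : k (L + u) = x := by
    rw [k2 _ ⟨hLu, le_rfl⟩, ← hc0]; congr 1; ring
  have hd : dist x y' = L + u := by
    rw [← hk0, ← hkM, hkgeo _ ⟨hM, le_rfl⟩ 0 ⟨le_rfl, hM⟩, sub_zero, abs_of_nonneg hM]
  rw [hd]
  exact ⟨fun s => k (L + u - s), by simpa using hkM, by simpa using hk0,
    by simpa using hkgeo.comp_sub (L + u)⟩

theorem IsLengthMetric.preconnectedSpace (hX : IsLengthMetric X) : PreconnectedSpace X := by
  rcases isEmpty_or_nonempty X with h | h
  · infer_instance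
  · have : PathConnectedSpace X := ⟨h, fun x y => by
      obtain ⟨γ, -⟩ := hX x y (dist x y + 1) (by linarith)
      exact ⟨γ⟩⟩
    infer_instance

/-- The set of end points of geodesics from `x` is open and closed. -/
theorem IsRGraph.hasGeodesics (hX : IsRGraph X)
    (hneg : IsCondStrictNegDef (fun x y : X => (dist x y : ℂ))) : HasGeodesics X := by
  have := hX.isLengthMetric.preconnectedSpace
  intro x
  set S : Set X := {y | ∃ c : ℝ → X, c 0 = x ∧ c (dist x y) = y ∧ IsGeodesicOn c 0 (dist x y)}
    with hS
  have hopen : IsOpen S := Metric.isOpen_iff.2 fun y hy => by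
    obtain ⟨r, hr, h⟩ := hX.exists_geodesic_of_near hneg x y
    exact ⟨r, hr, fun y' hy' => h y (Metric.mem_ball_self hr) y' hy' hy⟩
  have hclosed : IsClosed S := ⟨Metric.isOpen_iff.2 fun y hy => by
    obtain ⟨r, hr, h⟩ := hX.exists_geodesic_of_near hneg x y
    exact ⟨r, hr, fun y' hy' hyS => hy (h y' hy' y (Metric.mem_ball_self hr) hyS)⟩⟩
  have hx : x ∈ S := ⟨fun _ => x, rfl, rfl, fun s hs s' hs' => by
    rw [dist_self, Icc_self, mem_singleton_iff] at hs hs'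
    simp [hs, hs']⟩
  have huniv : S = univ := IsClopen.eq_univ ⟨hclosed, hopen⟩ ⟨x, hx⟩
  exact fun y => (huniv ▸ mem_univ y : y ∈ S)

end RGraph

theorem mainTheorem4 {X : Type*} [MetricSpace X] (hX : IsRGraph X) :
    IsCondStrictNegDef (fun x y : X => (dist x y : ℂ)) ↔ IsRTree X := by
  refine ⟨fun hneg => ?_, fun htree => htree.fourPointOn.isCondStrictNegDef⟩
  have hgeo := hX.hasGeodesics hneg
  exact ((hX.hasStraightConcat hneg).fourPointOn hgeo).isRTree hgeo
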